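/- Let $k$ be an infinite field and let $R=\bigoplus_{n\ge 0}R_n$ be a standard graded $k$-algebra, that is, $R\neq 0$, $R_0=k$, and $R$ is generated as a $k$-algebra by the finite-dimensional $k$-vector space $R_1$; put $\mathfrak m=\bigoplus_{n\ge 1}R_n$. Let $d\ge 0$ and let $I\subset R$ be a $d$-equigenerated homogeneous ideal, that is, an ideal generated by forms of degree $d$. Let $\mathcal R(I)=\bigoplus_{n\ge 0}I^nt^n\subset R[t]$ be the Rees algebra of $I$, let ${\rm gr}_I(R)=\mathcal R(I)/I\mathcal R(I)$ be the associated graded ring, let $\mathcal F(I)=\mathcal R(I)/\mathfrak m\mathcal R(I)$ be the special fiber, and let $\ell(I)=\dim\mathcal F(I)$ be the analytic spread of $I$. Suppose that $I$ is equimultiple, that is, ${\rm ht}\,I=\ell(I)$. If ${\rm gr}_I(R)$ is Cohen--Macaulay, then so is $\mathcal F(I)$. -/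

import Mathlib

universe u v

section CohenMacaulay

/-- The depth of a local ring `A`: the supremum of the lengths of the `A`-regular sequences
contained in its maximal ideal. -/
noncomputable def localDepth (A : Type u) [CommRing A] [IsLocalRing A] : ℕ∞ :=
  ⨆ rs ∈ {rs : List A | RingTheory.Sequence.IsRegular A rs ∧
    ∀ r ∈ rs, r ∈ IsLocalRing.maximalIdeal A}, (rs.length : ℕ∞)

/-- A commutative ring is Cohen-Macaulay if it is Noetherian and each of its localizations at a
maximal ideal has depth equal to its Krull dimension. -/
structure IsCohenMacaulayRing (A : Type u) [CommRing A] : Prop where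
  isNoetherianRing : IsNoetherianRing A
  depth_eq_dim : ∀ (p : Ideal A) [p.IsMaximal],
    (localDepth (Localization.AtPrime p) : WithBot ℕ∞) = ringKrullDim (Localization.AtPrime p)

end CohenMacaulay

section Graded

variable {k : Type v} {R : Type u} [Field k] [CommRing R] [Algebra k R]

/-- `R = ⨁ 𝒜 n` is a standard graded algebra over the field `k`: it is nonzero, its degree `0`
part is `k`, and it is generated as a `k`-algebra by its degree `1` part, which is a
finite-dimensional vector space. -/
structure IsStandardGraded (𝒜 : ℕ → Submodule k R) [GradedAlgebra 𝒜] : Prop where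
  nontrivial : Nontrivial R
  zero_eq : 𝒜 0 = 1
  finite_one : Module.Finite k (𝒜 1)
  adjoin_one : Algebra.adjoin k (𝒜 1 : Set R) = ⊤

/-- `I` is `d`-equigenerated: it is generated by forms of degree `d`. Such an ideal is
homogeneous. -/
def Ideal.IsEquigenerated (𝒜 : ℕ → Submodule k R) (d : ℕ) (I : Ideal R) : Prop :=
  Ideal.span ((I : Set R) ∩ (𝒜 d : Set R)) = I

/-- The associated graded ring `gr_I(R) = R[It] / I R[It]`. -/
abbrev AssociatedGradedRing (I : Ideal R) : Type u :=
  reesAlgebra I ⧸ I.map (algebraMap R (reesAlgebra I))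

/-- The special fiber `R[It] / 𝔪 R[It]`, where `𝔪` is the irrelevant ideal, the ideal of
elements without constant term. -/
abbrev SpecialFiber (𝒜 : ℕ → Submodule k R) [GradedAlgebra 𝒜] (I : Ideal R) : Type u :=
  reesAlgebra I ⧸ (HomogeneousIdeal.irrelevant 𝒜).toIdeal.map (algebraMap R (reesAlgebra I))

/-- The analytic spread: the Krull dimension of the special fiber. -/
noncomputable def analyticSpread (𝒜 : ℕ → Submodule k R) [GradedAlgebra 𝒜] (I : Ideal R) :
    WithBot ℕ∞ :=
  ringKrullDim (SpecialFiber 𝒜 I)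

/-- `I` is equimultiple: its height equals its analytic spread. -/
def Ideal.IsEquimultiple (𝒜 : ℕ → Submodule k R) [GradedAlgebra 𝒜] (I : Ideal R) : Prop :=
  (I.height : WithBot ℕ∞) = analyticSpread 𝒜 I

end Graded

/-! Let `V` be a finite-dimensional space of forms of degree `d` generating `I`. The special fiber
is the subalgebra `B = k[Vt]` of `R[t]` (`fiberAlgebra.bijective_mk_toRees`): elements of `V ^ n`
have degree `nd`, while `𝔪 I ^ n` lives in degrees above `nd`. Hence `B` maps to `G = gr_I(R)` and
is a retract of it.

Since `k` is infinite, `B` has a system of parameters `a` made of algebraically independent linear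
forms, and their number is `dim B = ht I`. Let `M` be the prime of `G` over the irrelevant ideal of
`B`. Modulo `a`, the ring `G` is integral over `R` and killed by `I`, so `ht I + ht (M/(a)) ≤ ht 𝔪`
(`Ideal.height_add_height_le_height_comap`). Specialization in the extended Rees algebra gives `ht 𝔪
≤ ht M` (`height_le_height_of_associatedGraded`). Thus `a` is part of a system of parameters of the
Cohen-Macaulay ring `G_M`, hence regular there (`isWeaklyRegular_localization_of_height_le`).

Homogeneous lifts of a `k`-basis of `B/(a)` stay independent in `G_M/(a)` because of the retraction.
Regularity of `a` then makes them independent over `k[a]`, and graded Nakayama makes them span. So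
`B` is finite free over a polynomial ring (`IsStandardGraded.finite_flat_aeval_of_retract`), and
therefore Cohen-Macaulay (`isCohenMacaulayRing_of_finite_of_flat`). -/

/-! ### Local rings with depth equal to dimension: systems of parameters are regular. -/

section LocalCohenMacaulay

open RingTheory.Sequence IsLocalRing

variable {S : Type*} [CommRing S] [IsLocalRing S] [IsNoetherianRing S]

lemma RingTheory.Sequence.IsRegular.length_le_ringKrullDim {rs : List S} (h : IsRegular S rs) :
    (rs.length : WithBot ℕ∞) ≤ ringKrullDim S := by
  rw [← ringKrullDim_add_length_eq_ringKrullDim_of_isRegular rs h]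
  have hne : Ideal.ofList rs ≠ ⊤ := by simpa using h.top_ne_smul.symm
  have : Nontrivial (S ⧸ Ideal.ofList rs) := Ideal.Quotient.nontrivial_iff.mpr hne
  exact le_add_of_nonneg_left ringKrullDim_nonneg_of_nontrivial

lemma localDepth_le_ringKrullDim : (localDepth S : WithBot ℕ∞) ≤ ringKrullDim S := by
  rw [← maximalIdeal_height_eq_ringKrullDim, WithBot.coe_le_coe]
  refine iSup₂_le fun rs hrs => ?_
  have := hrs.1.length_le_ringKrullDim
  rw [← maximalIdeal_height_eq_ringKrullDim] at this
  exact_mod_cast this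

/-- The dimension of a Noetherian local ring is finite, so the supremum defining the depth is
attained. -/
lemma exists_isRegular_of_localDepth_eq
    (h : (localDepth S : WithBot ℕ∞) = ringKrullDim S) :
    ∃ rs : List S, IsRegular S rs ∧ (∀ r ∈ rs, r ∈ maximalIdeal S) ∧
      (rs.length : WithBot ℕ∞) = ringKrullDim S := by
  obtain ⟨n, hn⟩ := ENat.ne_top_iff_exists.mp (Ideal.height_ne_top_of_isPrime (I := maximalIdeal S))
  rw [← maximalIdeal_height_eq_ringKrullDim, ← hn, WithBot.coe_inj] at h
  rw [← maximalIdeal_height_eq_ringKrullDim, ← hn]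
  by_contra! hcon
  have hlt : ∀ rs : List S, IsRegular S rs → (∀ r ∈ rs, r ∈ maximalIdeal S) → rs.length + 1 ≤ n := by
    intro rs h1 h2
    have h3 := h1.length_le_ringKrullDim
    rw [← maximalIdeal_height_eq_ringKrullDim, ← hn] at h3
    have h4 := hcon rs h1 h2
    have h5 : rs.length ≤ n := by exact_mod_cast h3
    have h6 : rs.length ≠ n := by
      rintro h6
      exact h4 (by rw [h6]; rfl)
    omega
  -- The empty sequence forces `1 ≤ n`, so that the truncated `n - 1` is a genuine predecessor.
  have h1n := hlt [] (IsRegular.nil S S) (by simp)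
  have : localDepth S ≤ ((n - 1 : ℕ) : ℕ∞) := by
    refine iSup₂_le fun rs hrs => ?_
    have := hlt rs hrs.1 hrs.2
    exact_mod_cast (by omega : rs.length ≤ n - 1)
  rw [h] at this
  have : n ≤ n - 1 := by exact_mod_cast this
  simp at h1n
  omega

omit [IsLocalRing S] in
-- The zero divisors on `S/K` form the union of its associated primes, all of which contain `K`. If
-- `x` lay in one of them, so would `z`.
lemma isSMulRegular_quotient_of_forall_isPrime {K : Ideal S} {x z : S}
    (hz : IsSMulRegular (S ⧸ (K • ⊤ : Ideal S)) z)
    (h : ∀ P : Ideal S, P.IsPrime → K ≤ P → x ∈ P → z ∈ P) :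
    IsSMulRegular (S ⧸ (K • ⊤ : Ideal S)) x := by
  by_contra hx
  have key := biUnion_associatedPrimes_eq_compl_regular S (S ⧸ (K • ⊤ : Ideal S))
  have hx' : x ∈ ⋃ p ∈ associatedPrimes S (S ⧸ (K • ⊤ : Ideal S)), (p : Set S) := by
    rw [key]; exact hx
  simp only [Set.mem_iUnion, exists_prop] at hx'
  obtain ⟨P, hP, hxP⟩ := hx'
  have hKP : K ≤ P := by
    have := hP.annihilator_le
    refine le_trans ?_ this
    intro r hr
    rw [Submodule.mem_annihilator]
    intro m _
    obtain ⟨m, rfl⟩ := Submodule.Quotient.mk_surjective _ m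
    rw [← Submodule.Quotient.mk_smul, Submodule.Quotient.mk_eq_zero]
    exact Submodule.smul_mem_smul hr trivial
  have hzP := h P hP.isPrime hKP hxP
  have : z ∈ ⋃ p ∈ associatedPrimes S (S ⧸ (K • ⊤ : Ideal S)), (p : Set S) :=
    Set.mem_biUnion hP hzP
  rw [key] at this
  exact this hz

/-- An exchange argument. Drop the last entries `y`, `x` of the two sequences and choose one `z`
that can replace both: it is regular after `zs ++ ys` and a parameter after `zs ++ xs`. Move `z`
into the common prefix, where induction applies, permute it back to the end, and finally trade it
for `x`. -/
lemma isWeaklyRegular_append_of_isWeaklyRegular_append (n : ℕ) : ∀ (zs ys xs : List S),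
    ys.length = n → xs.length = n → (∀ r ∈ zs ++ ys, r ∈ maximalIdeal S) →
    (∀ r ∈ xs, r ∈ maximalIdeal S) → IsWeaklyRegular S (zs ++ ys) →
    (∀ P : Ideal S, P.IsPrime → Ideal.ofList (zs ++ xs) ≤ P → P = maximalIdeal S) →
    IsWeaklyRegular S (zs ++ xs) := by
  induction n with
  | zero =>
    intro zs ys xs hy hx _ _ h _
    rw [List.length_eq_zero_iff] at hy hx
    simpa [hy, hx] using h
  | succ n ih =>
    intro zs ys xs hy hx hmy hmx hreg hP
    obtain ⟨ys, y, rfl⟩ : ∃ l a, ys = l ++ [a] :=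
      ⟨_, _, (List.dropLast_concat_getLast (List.ne_nil_of_length_eq_add_one hy)).symm⟩
    obtain ⟨xs, x, rfl⟩ : ∃ l a, xs = l ++ [a] :=
      ⟨_, _, (List.dropLast_concat_getLast (List.ne_nil_of_length_eq_add_one hx)).symm⟩
    simp only [List.length_append, List.length_singleton, add_left_inj] at hy hx
    have hht : ((zs.length + (n + 1) : ℕ) : ℕ∞) ≤ (maximalIdeal S).height := by
      have := (IsRegular.of_isWeaklyRegular_of_mem_maximalIdeal S hmy hreg).length_le_ringKrullDim
      rw [← maximalIdeal_height_eq_ringKrullDim] at this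
      have h2 : (((zs ++ (ys ++ [y])).length : ℕ) : ℕ∞) ≤ (maximalIdeal S).height := by
        exact_mod_cast this
      simpa [hy] using h2
    rw [← List.append_assoc, isWeaklyRegular_append_iff, isWeaklyRegular_singleton_iff] at hreg
    obtain ⟨hreg1, hy1⟩ := hreg
    set T := associatedPrimes S (S ⧸ (Ideal.ofList (zs ++ ys) • ⊤ : Ideal S)) ∪
      (Ideal.ofList (zs ++ xs)).minimalPrimes with hT
    have hTfin : T.Finite := (associatedPrimes.finite S _).union
      (Ideal.finite_minimalPrimes_of_isNoetherianRing S _)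
    have hTprime : ∀ P ∈ T, P.IsPrime := by
      rintro P (hP | hP)
      · exact hP.isPrime
      · exact hP.1.1
    have key := biUnion_associatedPrimes_eq_compl_regular S
      (S ⧸ (Ideal.ofList (zs ++ ys) • ⊤ : Ideal S))
    -- The maximal ideal is not associated since it contains the regular element `y`. It is not
    -- minimal over `zs ++ xs` by Krull's height theorem: its height is at least `zs.length + n +
    -- 1`, one more than the number of generators.
    have hmT : maximalIdeal S ∉ T := by
      rintro (hm | hm)
      · have : y ∈ ⋃ p ∈ associatedPrimes S (S ⧸ (Ideal.ofList (zs ++ ys) • ⊤ : Ideal S)),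
            (p : Set S) := Set.mem_biUnion hm (hmy y (by simp))
        rw [key] at this
        exact this hy1
      · classical
        have := Ideal.height_le_card_of_mem_minimalPrimes_span_finset
          (s := (zs ++ xs).toFinset) (by
            convert hm using 3
            ext; simp)
        have h2 : (zs ++ xs).toFinset.card ≤ zs.length + n := by
          refine (List.toFinset_card_le _).trans ?_
          simp [hx]
        have h3 := hht.trans this
        have h4 : zs.length + (n + 1) ≤ (zs ++ xs).toFinset.card := by exact_mod_cast h3
        omega
    obtain ⟨z, hzm, hzT⟩ : ∃ z ∈ maximalIdeal S, ∀ P ∈ T, z ∉ P := by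
      by_contra! hcon
      have hsub : (maximalIdeal S : Set S) ⊆ ⋃ P ∈ T, ((id P : Ideal S) : Set S) := by
        intro z hz
        obtain ⟨P, hP, hzP⟩ := hcon z hz
        exact Set.mem_biUnion hP hzP
      obtain ⟨P, hPT, hle⟩ := (Ideal.subset_union_prime_finite hTfin (f := id) ⊥ ⊥
        (fun P hP _ _ => hTprime P hP)).mp hsub
      have := (maximalIdeal.isMaximal S).eq_of_le (hTprime P hPT).ne_top hle
      exact hmT (this ▸ hPT)
    have hz1 : IsSMulRegular (S ⧸ (Ideal.ofList (zs ++ ys) • ⊤ : Ideal S)) z := by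
      by_contra hz
      have : z ∈ ⋃ p ∈ associatedPrimes S (S ⧸ (Ideal.ofList (zs ++ ys) • ⊤ : Ideal S)),
          (p : Set S) := by rw [key]; exact hz
      simp only [Set.mem_iUnion, exists_prop] at this
      obtain ⟨P, hP, hzP⟩ := this
      exact hzT P (Or.inl hP) hzP
    have hPz : ∀ P : Ideal S, P.IsPrime → Ideal.ofList (zs ++ xs ++ [z]) ≤ P →
        P = maximalIdeal S := by
      intro P hPp hle
      by_contra hne
      have hlt : P < maximalIdeal S := lt_of_le_of_ne (le_maximalIdeal hPp.ne_top) hne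
      rw [Ideal.ofList_append, sup_le_iff] at hle
      have hmin : maximalIdeal S ∈
          (Ideal.span (insert x {r | r ∈ zs ++ xs})).minimalPrimes := by
        refine ⟨⟨inferInstance, ?_⟩, fun Q hQ _ => ?_⟩
        · rw [Ideal.span_le]
          rintro r (rfl | hr)
          · exact hmx _ (by simp)
          · rcases List.mem_append.mp hr with hr | hr
            · exact hmy r (by simp [hr])
            · exact hmx r (by simp [hr])
        · refine (hP Q hQ.1 (le_trans (Ideal.span_mono ?_) hQ.2)).ge
          intro r hr
          simp only [Set.mem_ofPred_eq, List.mem_append, List.mem_singleton,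
            Set.mem_insert_iff] at hr ⊢
          tauto
      -- Adding the single element `x` already makes the maximal ideal minimal, so a strictly
      -- smaller prime over `zs ++ xs` must be minimal over it; `z` avoids those.
      have := Ideal.mem_minimalPrimes_span_of_mem_minimalPrimes_span_insert hlt x _ hmin
        {r | r ∈ zs ++ xs} (fun r hr => hle.1 (Ideal.subset_span hr))
        (fun r hr => Ideal.le_radical (Ideal.subset_span (Set.mem_insert_of_mem _ hr)))
      exact hzT P (Or.inr this) (hle.2 (Ideal.subset_span (by simp)))
    have hmz : ∀ r ∈ zs ++ ys ++ [z], r ∈ maximalIdeal S := by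
      intro r hr
      rcases List.mem_append.mp hr with hr | hr
      · exact hmy r (by rw [← List.append_assoc]; exact List.mem_append_left _ hr)
      · rw [List.mem_singleton.mp hr]; exact hzm
    have hmz' : ∀ r ∈ zs ++ [z] ++ xs, r ∈ maximalIdeal S := by
      intro r hr
      simp only [List.append_assoc, List.mem_append, List.mem_singleton] at hr
      rcases hr with hr | rfl | hr
      · exact hmy r (by simp [hr])
      · exact hzm
      · exact hmx r (by simp [hr])
    have h1 : IsWeaklyRegular S (zs ++ ys ++ [z]) := by
      rw [isWeaklyRegular_append_iff, isWeaklyRegular_singleton_iff]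
      exact ⟨hreg1, hz1⟩
    have hperm : ∀ l : List S, (zs ++ l ++ [z]).Perm (zs ++ [z] ++ l) := fun l => by
      rw [List.append_assoc, List.append_assoc]
      exact List.Perm.append_left _ List.perm_append_comm
    have h2 : IsWeaklyRegular S (zs ++ [z] ++ xs) := by
      refine ih (zs ++ [z]) ys xs hy hx (fun r hr => hmz r ((hperm ys).mem_iff.mpr hr))
        (fun r hr => hmx r (by simp [hr]))
        (isWeaklyRegular_of_perm_of_subset_maximalIdeal h1 (hperm ys) hmz) ?_
      intro P hPp hle
      refine hPz P hPp (le_trans (Ideal.span_mono ?_) hle)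
      intro r hr
      exact (hperm xs).mem_iff.mp hr
    have h3 := isWeaklyRegular_of_perm_of_subset_maximalIdeal h2 (hperm xs).symm hmz'
    rw [isWeaklyRegular_append_iff, isWeaklyRegular_singleton_iff] at h3
    rw [← List.append_assoc, isWeaklyRegular_append_iff, isWeaklyRegular_singleton_iff]
    refine ⟨h3.1, isSMulRegular_quotient_of_forall_isPrime h3.2 fun P hPp hle hxP => ?_⟩
    rw [hP P hPp (by
      rw [← List.append_assoc, Ideal.ofList_append, sup_le_iff]
      exact ⟨hle, by simpa using hxP⟩)]
    exact hzm

/-- In a local ring whose depth equals its dimension, every system of parameters is a regular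
sequence. -/
lemma isWeaklyRegular_of_localDepth_eq_ringKrullDim
    (h : (localDepth S : WithBot ℕ∞) = ringKrullDim S) (xs : List S)
    (hx : ∀ r ∈ xs, r ∈ maximalIdeal S) (hlen : (xs.length : WithBot ℕ∞) ≤ ringKrullDim S)
    (hP : ∀ P : Ideal S, P.IsPrime → Ideal.ofList xs ≤ P → P = maximalIdeal S) :
    IsWeaklyRegular S xs := by
  obtain ⟨ys, hreg, hy, hylen⟩ := exists_isRegular_of_localDepth_eq h
  have hle : xs.length ≤ ys.length := by
    rw [← hylen] at hlen
    exact_mod_cast hlen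
  have hge : ys.length ≤ xs.length := by
    classical
    have hmin : maximalIdeal S ∈ (Ideal.span (xs.toFinset : Set S)).minimalPrimes := by
      have : (xs.toFinset : Set S) = {r | r ∈ xs} := by ext; simp
      rw [this]
      exact ⟨⟨inferInstance, Ideal.span_le.mpr hx⟩, fun Q hQ _ => (hP Q hQ.1 hQ.2).ge⟩
    have h1 := Ideal.height_le_card_of_mem_minimalPrimes_span_finset hmin
    rw [← maximalIdeal_height_eq_ringKrullDim] at hylen
    have h2 : (ys.length : ℕ∞) = (maximalIdeal S).height := by exact_mod_cast hylen
    rw [← h2] at h1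
    have h3 : ys.length ≤ xs.toFinset.card := by exact_mod_cast h1
    exact h3.trans (List.toFinset_card_le _)
  simpa using isWeaklyRegular_append_of_isWeaklyRegular_append ys.length [] ys xs rfl
    (le_antisymm hle hge) (by simpa using hy) hx (by simpa using hreg.toIsWeaklyRegular)
    (by simpa using hP)

end LocalCohenMacaulay

/-! ### Polynomial rings, and finite flat algebras over them. -/

section FlatOverPolynomialRing

open RingTheory.Sequence

lemma Polynomial.Monic.isSMulRegular_quotient_map_C {C : Type*} [CommRing C] (J : Ideal C)
    {f : Polynomial C} (hf : f.Monic) :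
    IsSMulRegular (Polynomial C ⧸ J.map Polynomial.C) f := by
  rw [isSMulRegular_quotient_iff_mem_of_smul_mem]
  have key : ∀ g : Polynomial C, g ∈ J.map Polynomial.C ↔ g.map (Ideal.Quotient.mk J) = 0 := by
    intro g
    simp [Ideal.mem_map_C_iff, Polynomial.ext_iff, Ideal.Quotient.eq_zero_iff_mem]
  intro x hx
  rw [key] at hx ⊢
  rw [smul_eq_mul, Polynomial.map_mul] at hx
  exact ((hf.map _).mul_right_eq_zero_iff).mp hx

/-- Over a Jacobson ring `P` contracts to a maximal ideal `p`, and `P` is generated by `p` and a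
monic `f`. A regular sequence in `p` survives the flat extension to `C[X]`, and a monic polynomial
is regular modulo any extended ideal. -/
lemma exists_isWeaklyRegular_polynomial {C : Type*} [CommRing C] [IsJacobsonRing C] {n : ℕ}
    (h : ∀ p : Ideal C, p.IsMaximal →
      ∃ rs : List C, rs.length = n ∧ (∀ r ∈ rs, r ∈ p) ∧ IsWeaklyRegular C rs)
    (P : Ideal (Polynomial C)) (hP : P.IsMaximal) :
    ∃ rs : List (Polynomial C), rs.length = n + 1 ∧ (∀ r ∈ rs, r ∈ P) ∧
      IsWeaklyRegular (Polynomial C) rs := by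
  have hmax : (P.comap Polynomial.C).IsMaximal :=
    Polynomial.isMaximal_comap_C_of_isJacobsonRing P
  obtain ⟨rs, hlen, hmem, hreg⟩ := h _ hmax
  have hne : P ≠ (P.comap Polynomial.C).map Polynomial.C := by
    intro heq
    have h1 := (Ideal.Quotient.maximal_ideal_iff_isField_quotient P).mp hP
    rw [heq] at h1
    exact Polynomial.not_isField (C ⧸ P.comap Polynomial.C)
      ((Ideal.polynomialQuotientEquivQuotientPolynomial
        (P.comap Polynomial.C)).toMulEquiv.isField h1)
  obtain ⟨f, hf, hPf⟩ := Polynomial.exists_monic_span_sup_map_eq C P hmax hne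
  refine ⟨rs.map Polynomial.C ++ [f], by simp [hlen], ?_, ?_⟩
  · intro r hr
    rcases List.mem_append.mp hr with hr | hr
    · obtain ⟨c, hc, rfl⟩ := List.mem_map.mp hr
      exact hmem c hc
    · rw [List.mem_singleton.mp hr, hPf]
      exact Ideal.mem_sup_right (Ideal.mem_span_singleton_self f)
  · rw [isWeaklyRegular_append_iff, isWeaklyRegular_singleton_iff]
    refine ⟨hreg.of_flat, ?_⟩
    have := hf.isSMulRegular_quotient_map_C (Ideal.ofList rs)
    rwa [← Ideal.mul_top (Ideal.map _ _), ← smul_eq_mul, Ideal.map_ofList] at this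

lemma exists_isWeaklyRegular_of_ringEquiv {C D : Type*} [CommRing C] [CommRing D] (e : C ≃+* D)
    {n : ℕ} (h : ∀ p : Ideal C, p.IsMaximal →
      ∃ rs : List C, rs.length = n ∧ (∀ r ∈ rs, r ∈ p) ∧ IsWeaklyRegular C rs)
    (P : Ideal D) (hP : P.IsMaximal) :
    ∃ rs : List D, rs.length = n ∧ (∀ r ∈ rs, r ∈ P) ∧ IsWeaklyRegular D rs := by
  obtain ⟨rs, hlen, hmem, hreg⟩ := h (P.comap e) (Ideal.comap_isMaximal_of_equiv e)
  refine ⟨rs.map e, by simpa using hlen, ?_, ?_⟩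
  · intro r hr
    obtain ⟨c, hc, rfl⟩ := List.mem_map.mp hr
    exact hmem c hc
  · refine (AddEquiv.isWeaklyRegular_congr (e := e.toAddEquiv) ?_).mp hreg
    rw [List.forall₂_map_right_iff, List.forall₂_same]
    intro r _ x
    simp

lemma MvPolynomial.exists_isWeaklyRegular_of_isMaximal (k : Type*) [Field k] (n : ℕ) :
    ∀ P : Ideal (MvPolynomial (Fin n) k), P.IsMaximal → ∃ rs : List (MvPolynomial (Fin n) k),
      rs.length = n ∧ (∀ r ∈ rs, r ∈ P) ∧ IsWeaklyRegular (MvPolynomial (Fin n) k) rs := by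
  induction n with
  | zero => exact fun P _ => ⟨[], rfl, by simp, IsWeaklyRegular.nil _ _⟩
  | succ n ih =>
    exact exists_isWeaklyRegular_of_ringEquiv (MvPolynomial.finSuccEquiv k n).symm.toRingEquiv
      (exists_isWeaklyRegular_polynomial ih)

lemma ringKrullDim_le_of_isIntegral (A B : Type*) [CommRing A] [CommRing B] [Algebra A B]
    [Algebra.IsIntegral A B] : ringKrullDim B ≤ ringKrullDim A :=
  Order.krullDim_le_of_strictMono (PrimeSpectrum.comap (algebraMap A B))
    fun _ _ h => Ideal.IsIntegral.comap_lt_comap h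

lemma ringKrullDim_le_of_isIntegral_of_injective (A B : Type*) [CommRing A] [CommRing B]
    [Algebra A B] [Algebra.IsIntegral A B] (h : Function.Injective (algebraMap A B)) :
    ringKrullDim A ≤ ringKrullDim B := by
  refine iSup_le fun l => ?_
  obtain ⟨Q, -, hQ, hQl⟩ := Ideal.exists_ideal_over_prime_of_isIntegral
    l.head.asIdeal (⊥ : Ideal B) (by
      rw [← RingHom.ker_eq_comap_bot, (RingHom.injective_iff_ker_eq_bot _).mp h]; exact bot_le)
  have : Q.LiesOver l.head.asIdeal := ⟨hQl.symm⟩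
  obtain ⟨L, hL, -⟩ := Ideal.exists_ltSeries_of_hasGoingUp l Q
  rw [← hL]
  exact Order.LTSeries.length_le_krullDim L

/-- A ring which is finite and flat over a polynomial ring over a field is Cohen-Macaulay. -/
lemma isCohenMacaulayRing_of_finite_of_flat (k : Type*) [Field k] (n : ℕ) (B : Type*) [CommRing B]
    [Algebra (MvPolynomial (Fin n) k) B] [Module.Finite (MvPolynomial (Fin n) k) B]
    [Module.Flat (MvPolynomial (Fin n) k) B] : IsCohenMacaulayRing B := by
  have hN : IsNoetherianRing B := IsNoetherianRing.of_finite (MvPolynomial (Fin n) k) B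
  refine ⟨hN, fun p hp => le_antisymm localDepth_le_ringKrullDim ?_⟩
  -- The local dimension is at most `n` by integrality. A regular sequence of length `n` below `p`
  -- stays regular by flatness, which bounds the depth from below.
  have hdim : ringKrullDim (Localization.AtPrime p) ≤ n := by
    rw [IsLocalization.AtPrime.ringKrullDim_eq_height p]
    refine Ideal.height_le_ringKrullDim_of_isPrime.trans
      ((ringKrullDim_le_of_isIntegral (MvPolynomial (Fin n) k) B).trans ?_)
    simp [MvPolynomial.ringKrullDim_of_isNoetherianRing]
  obtain ⟨rs, hlen, hmem, hreg⟩ := MvPolynomial.exists_isWeaklyRegular_of_isMaximal k n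
    (p.comap (algebraMap _ B)) (Ideal.isMaximal_comap_of_isIntegral_of_isMaximal p)
  have hreg' : IsWeaklyRegular B (rs.map (algebraMap _ B)) := hreg.of_flat
  have hmem' : ∀ r ∈ rs.map (algebraMap _ B), r ∈ p := by
    intro r hr
    obtain ⟨c, hc, rfl⟩ := List.mem_map.mp hr
    exact hmem c hc
  have h1 := hreg'.isRegular_of_isLocalization_of_mem (Localization.AtPrime p) p hmem'
  refine hdim.trans ?_
  have h2 : ((n : ℕ) : ℕ∞) ≤ localDepth (Localization.AtPrime p) := by
    refine le_iSup₂_of_le _ ⟨h1, ?_⟩ (by simp [hlen])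
    intro r hr
    obtain ⟨c, hc, rfl⟩ := List.mem_map.mp hr
    rw [IsLocalization.AtPrime.to_map_mem_maximal_iff _ p]
    exact hmem' c hc
  exact_mod_cast h2

end FlatOverPolynomialRing

/-! ### Heights under surjective and integral homomorphisms. -/

section Heights

lemma Ideal.height_le_height_comap_of_surjective {A B : Type*} [CommRing A] [CommRing B]
    {f : A →+* B} (hf : Function.Surjective f) (P : Ideal B) [P.IsPrime] :
    P.height ≤ (P.comap f).height := by
  have h := Order.height_le_height_apply_of_strictMono (PrimeSpectrum.comap f)
    (RingHom.strictMono_comap_of_surjective hf) ⟨P, inferInstance⟩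
  rwa [← PrimeSpectrum.height_eq_orderHeight, ← PrimeSpectrum.height_eq_orderHeight] at h

/-- If `A → B` is integral and kills `I`, then the height of a prime of `B` plus the height of `I`
is at most the height of the contracted prime. -/
lemma Ideal.height_add_height_le_height_comap {A B : Type*} [CommRing A] [CommRing B] [Algebra A B]
    [Algebra.IsIntegral A B] [IsNoetherianRing B] {I : Ideal A}
    (hI : I ≤ RingHom.ker (algebraMap A B)) (P : Ideal B) [P.IsPrime] :
    I.height + P.height ≤ (P.comap (algebraMap A B)).height := by
  -- Climb a chain of primes in `B`: every contraction contains `I`, which starts the induction, and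
  -- incomparability keeps the contracted inclusions strict.
  have key : ∀ (n : ℕ) (P : PrimeSpectrum B), (n : ℕ∞) ≤ Order.height P →
      I.height + n ≤ (P.asIdeal.comap (algebraMap A B)).height := by
    intro n
    induction n with
    | zero =>
      intro P _
      rw [Nat.cast_zero, add_zero]
      exact Ideal.height_mono (hI.trans (Ideal.ker_le_comap _))
    | succ n ih =>
      intro P hP
      have hfin : Order.height P < ⊤ := by
        rw [← PrimeSpectrum.height_eq_orderHeight]
        exact Ideal.height_lt_top_of_isPrime
      obtain ⟨Q, hQP, hQ⟩ := (Order.coe_lt_height_iff (n := n) hfin).mp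
        (lt_of_lt_of_le (by exact_mod_cast Nat.lt_succ_self n) hP)
      have h1 := ih Q hQ.ge
      have h2 := Ideal.height_add_one_le_of_lt_of_isPrime
        (Ideal.IsIntegral.comap_lt_comap (R := A)
          (show Q.asIdeal < P.asIdeal from hQP))
      rw [Nat.cast_add, Nat.cast_one, ← add_assoc]
      exact le_trans (by gcongr) h2
  obtain ⟨n, hn⟩ := ENat.ne_top_iff_exists.mp (Ideal.height_ne_top_of_isPrime (I := P))
  have := key n ⟨P, inferInstance⟩ (by rw [← PrimeSpectrum.height_eq_orderHeight, hn])
  rwa [hn] at this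

end Heights

/-! ### Specialization along a principal divisor. -/

section Specialization

lemma Ideal.dvd_map_of_mem_map {B A E : Type*} [CommRing B] [CommRing A] [CommRing E]
    (g : B →+* A) (f : A →+* E) {I : Ideal B} {y : E} (h : ∀ b ∈ I, y ∣ f (g b)) {a : A}
    (ha : a ∈ I.map g) : y ∣ f a := by
  have : I.map g ≤ (Ideal.span {y}).comap f := by
    rw [Ideal.map_le_iff_le_comap]
    intro b hb
    exact Ideal.mem_span_singleton.mpr (h b hb)
  exact Ideal.mem_span_singleton.mp (this ha)

open Polynomial

/-- Let `E` be generated over `A` by one element `y`, and let `G` be a ring surjecting onto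
`E / yE` compatibly with `A`. If a prime `Q` of `E` not containing `y` lies below the prime `M`
of `G`, then the height of `Q` is at most that of `M`. -/
lemma Ideal.height_le_height_of_specialization {A E G : Type*} [CommRing A] [CommRing E]
    [IsNoetherianRing E] [CommRing G] {ψ : A[X] →+* E} (hψ : Function.Surjective ψ)
    {π : A →+* G} (hπ : Function.Surjective π)
    (hker : ∀ a ∈ RingHom.ker π, ψ X ∣ ψ (C a)) (Q : Ideal E) [Q.IsPrime] (hQ : ψ X ∉ Q)
    (M : Ideal G) [M.IsPrime] (hQM : Q.comap ψ ≤ M.comap (π.comp constantCoeff)) :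
    Q.height ≤ M.height := by
  have hkerψ : RingHom.ker ψ ≤ M.comap (π.comp constantCoeff) := (Ideal.ker_le_comap ψ).trans hQM
  set ME : Ideal E := (M.comap (π.comp constantCoeff)).map ψ with hME
  have : ME.IsPrime := Ideal.map_isPrime_of_surjective hψ hkerψ
  have hMEmem : ∀ f, ψ f ∈ ME ↔ π (f.coeff 0) ∈ M := by
    intro f
    rw [← Ideal.mem_comap, hME, Ideal.comap_map_of_surjective _ hψ, 
      ← RingHom.ker_eq_comap_bot, sup_eq_left.mpr hkerψ]
    rfl
  set y : E := ψ X with hy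
  have hyM : y ∈ ME := (hMEmem _).mpr (by simp)
  -- The inclusion is strict because of `y`, which gains one in height; passing to `E / yE` loses at
  -- most one. So `Q` is no higher than the image of `ME`, and that ring is a quotient of `G`.
  have hlt : Q < ME := by
    refine SetLike.lt_iff_le_and_exists.mpr ⟨fun x hx => ?_, y, hyM, hQ⟩
    obtain ⟨f, rfl⟩ := hψ x
    exact (hMEmem f).mpr (hQM hx)
  have h1 := Ideal.height_add_one_le_of_lt_of_isPrime hlt
  have h2 := Ideal.height_le_height_add_one_of_mem hyM
  set N : Ideal (E ⧸ Ideal.span {y}) := ME.map (Ideal.Quotient.mk (Ideal.span {y})) with hN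
  have hyker : Ideal.span {y} ≤ ME := by
    rw [Ideal.span_singleton_le_iff_mem]
    exact hyM
  have : N.IsPrime := Ideal.map_isPrime_of_surjective Ideal.Quotient.mk_surjective
    (by rwa [Ideal.mk_ker])
  have h3 : Q.height ≤ N.height :=
    (ENat.add_le_add_iff_right (by simp)).mp (h1.trans h2)
  refine h3.trans ?_
  set θ : A →+* E ⧸ Ideal.span {y} := (Ideal.Quotient.mk (Ideal.span {y})).comp (ψ.comp C) with hθ
  have hθs : Function.Surjective θ := by
    intro x
    obtain ⟨x, rfl⟩ := Ideal.Quotient.mk_surjective x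
    obtain ⟨f, rfl⟩ := hψ x
    refine ⟨f.coeff 0, ?_⟩
    rw [hθ, RingHom.comp_apply, Ideal.Quotient.eq, RingHom.comp_apply, ← map_sub,
      Ideal.mem_span_singleton]
    refine map_dvd ψ ?_
    rw [X_dvd_iff]
    simp
  have hθI : RingHom.ker π ≤ RingHom.ker θ := by
    intro a ha
    rw [RingHom.mem_ker, hθ, RingHom.comp_apply, Ideal.Quotient.eq_zero_iff_mem,
      Ideal.mem_span_singleton]
    exact hker a ha
  set θ' : G →+* E ⧸ Ideal.span {y} := RingHom.liftOfSurjective π hπ ⟨θ, hθI⟩ with hθ'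
  have hθ'π : ∀ a, θ' (π a) = θ a := fun a => RingHom.liftOfRightInverse_comp_apply _ _ _ _ a
  have hθ's : Function.Surjective θ' := by
    intro x
    obtain ⟨a, rfl⟩ := hθs x
    exact ⟨π a, hθ'π a⟩
  have hNM : N.comap θ' = M := by
    ext x
    obtain ⟨x, rfl⟩ := hπ x
    rw [Ideal.mem_comap, hθ'π, hθ, RingHom.comp_apply, ← Ideal.mem_comap, hN,
      Ideal.comap_map_mk hyker, RingHom.comp_apply, hMEmem]
    simp
  rw [← hNM]
  exact Ideal.height_le_height_comap_of_surjective hθ's N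

end Specialization

/-! ### The extended Rees algebra and the dimension of the associated graded ring. -/

section ExtendedRees

lemma RingHom.sub_mem_ker_of_eq {A L : Type*} [Ring A] [Semiring L] [IsRightCancelAdd L]
    {f : A →+* L} {x y : A} (h : f x = f y) : x - y ∈ RingHom.ker f := by
  rw [RingHom.mem_ker]
  have : f (x - y) + f y = 0 + f y := by rw [← map_add, sub_add_cancel, h, zero_add]
  exact add_right_cancel this

open Polynomial

variable {R A : Type*} [CommRing R] [CommRing A] (j : A →+* R[X])

/-- The ring homomorphism `R[It][y] → R[t, t⁻¹]` sending `y` to `t⁻¹`; its range is the extended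
Rees algebra. -/
noncomputable def extendedReesHom : A[X] →+* LaurentPolynomial R :=
  Polynomial.eval₂RingHom (toLaurent.comp j) (LaurentPolynomial.T (-1))

variable {j} {I : Ideal R}

lemma extendedReesHom_C (c : A) :
    extendedReesHom j (C c) = toLaurent (j c) := by
  simp [extendedReesHom]

lemma extendedReesHom_X : extendedReesHom j X = LaurentPolynomial.T (-1) := by
  simp [extendedReesHom]

/-- The identity `r = t⁻¹ · (rt)`: it makes every element of `I` a multiple of `t⁻¹` in the extended
Rees algebra. -/
lemma sub_X_mul_mem_ker_extendedReesHom {x y : A} {r : R} (hx : j x = C r)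
    (hy : j y = monomial 1 r) : C x - X * C y ∈ RingHom.ker (extendedReesHom j) := by
  refine RingHom.sub_mem_ker_of_eq ?_
  rw [map_mul, extendedReesHom_X, extendedReesHom_C, extendedReesHom_C, hx, hy,
    ← C_mul_X_pow_eq_monomial, toLaurent_C_mul_X_pow, toLaurent_C, mul_left_comm,
    ← LaurentPolynomial.T_add]
  simp

/-- The term `a yⁿ` contributes the coefficient of `tⁿ` in `j a`, which lies in `I ^ n`. Modulo `m ⊇
I` only the term with `n = 0` counts. -/
lemma coeff_extendedReesHom_sub_mem (hj : ∀ a n, (j a).coeff n ∈ I ^ n)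
    {m : Ideal R} (hm : I ≤ m) (f : A[X]) :
    (extendedReesHom j f).coeff 0 - (j (f.coeff 0)).coeff 0 ∈ m := by
  induction f using Polynomial.induction_on' with
  | add p q hp hq =>
    have := m.add_mem hp hq
    rw [map_add, Polynomial.coeff_add]
    convert this using 1
    simp
    ring
  | monomial n a =>
    have h : (extendedReesHom j (monomial n a)).coeff 0 = (j a).coeff n := by
      rw [← C_mul_X_pow_eq_monomial, map_mul, map_pow, extendedReesHom_C, extendedReesHom_X,
        LaurentPolynomial.T_pow, LaurentPolynomial.T,
        AddMonoidAlgebra.coeff_mul_single_eq_coeff_mul (m₂ := (n : ℤ)) (by intros; omega)]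
      simp only [LaurentPolynomial.coeff_toLaurent, mul_one]
      exact Finsupp.mapDomain_apply Nat.castEmbedding.injective _ n
    rw [h]
    rcases Nat.eq_zero_or_pos n with rfl | hn
    · simp
    · rw [Polynomial.coeff_monomial, if_neg hn.ne']
      simp only [map_zero, coeff_zero, sub_zero]
      exact hm (Ideal.pow_le_self hn.ne' (hj a n))

/-- The contraction of the extension of `p` to `R[t, t⁻¹]` along `R[It][y] → R[t, t⁻¹]`. -/
noncomputable def extendedReesPrime (j : A →+* R[X]) (p : Ideal R) : Ideal A[X] :=
  RingHom.ker ((AddMonoidAlgebra.mapRingHom ℤ (Ideal.Quotient.mk p)).comp (extendedReesHom j))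

lemma mem_extendedReesPrime {p : Ideal R} {x : A[X]} :
    x ∈ extendedReesPrime j p ↔ ∀ n, (extendedReesHom j x).coeff n ∈ p := by
  rw [extendedReesPrime, RingHom.mem_ker]
  constructor
  · intro h n
    have := congrArg (fun y => AddMonoidAlgebra.coeff y n) h
    simpa [Ideal.Quotient.eq_zero_iff_mem] using this
  · intro h
    ext n
    simpa [Ideal.Quotient.eq_zero_iff_mem] using h n

instance (p : Ideal R) [p.IsPrime] : (extendedReesPrime j p).IsPrime := by
  have : IsDomain (LaurentPolynomial (R ⧸ p)) := inferInstance
  exact RingHom.ker_isPrime _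

lemma ker_extendedReesHom_le (p : Ideal R) :
    RingHom.ker (extendedReesHom j) ≤ extendedReesPrime j p := by
  intro x hx
  rw [mem_extendedReesPrime, (RingHom.mem_ker).mp hx]
  simp

lemma extendedReesPrime_strictMono {g : R →+* A} (hg : ∀ r, j (g r) = C r)
    {p q : Ideal R} (h : p < q) :
    extendedReesPrime j p < extendedReesPrime j q := by
  obtain ⟨hle, x, hxq, hxp⟩ := SetLike.lt_iff_le_and_exists.mp h
  have hx : extendedReesHom j (C (g x)) = LaurentPolynomial.C x := by
    rw [extendedReesHom_C, hg, toLaurent_C]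
  refine SetLike.lt_iff_le_and_exists.mpr ⟨fun y hy => ?_, C (g x), ?_, ?_⟩
  · rw [mem_extendedReesPrime] at hy ⊢
    exact fun n => hle (hy n)
  · rw [mem_extendedReesPrime, hx]
    intro n
    simp only [LaurentPolynomial.C_apply]
    split_ifs <;> simp [hxq]
  · rw [mem_extendedReesPrime, hx]
    intro h
    exact hxp (by simpa using h 0)

/-- The dimension of the associated graded ring is at least that of the ring, locally at a prime
containing the ideal. -/
lemma height_le_height_of_associatedGraded [IsNoetherianRing A]
    (hj : ∀ a n, (j a).coeff n ∈ I ^ n) {g : R →+* A} (hg : ∀ r, j (g r) = C r)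
    (hI : ∀ r ∈ I, ∃ y, j y = monomial 1 r) {m : Ideal R} [m.IsPrime]
    (hm : I ≤ m) {G : Type*} [CommRing G] {π : A →+* G}
    (hπ : Function.Surjective π) (hker : RingHom.ker π = I.map g)
    (M : Ideal G) [M.IsPrime] (hM : ∀ x, (j x).coeff 0 ∈ m → π x ∈ M) :
    m.height ≤ M.height := by
  set K := RingHom.ker (extendedReesHom j) with hK
  set ψ := Ideal.Quotient.mk K with hψ
  have hψs : Function.Surjective ψ := Ideal.Quotient.mk_surjective
  have hKp : ∀ p : Ideal R, K ≤ extendedReesPrime j p := ker_extendedReesHom_le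
  have hprime : ∀ p : PrimeSpectrum R, ((extendedReesPrime j p.asIdeal).map ψ).IsPrime := fun p =>
    Ideal.map_isPrime_of_surjective hψs (by rw [hψ, Ideal.mk_ker]; exact hKp _)
  have hcomap : ∀ p : Ideal R,
      ((extendedReesPrime j p).map ψ).comap ψ = extendedReesPrime j p := fun p =>
    Ideal.comap_map_mk (hKp p)
  have := hprime ⟨m, inferInstance⟩
  -- Extending to `R[t, t⁻¹]` and contracting maps chains of primes of `R` to strict chains in the
  -- extended Rees algebra.
  have hchain : m.height ≤ ((extendedReesPrime j m).map ψ).height := by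
    have h := Order.height_le_height_apply_of_strictMono
      (fun p : PrimeSpectrum R => (⟨(extendedReesPrime j p.asIdeal).map ψ, hprime p⟩ :
        PrimeSpectrum (A[X] ⧸ K)))
      (fun p q h => by
        refine lt_of_le_not_ge (Ideal.map_mono (extendedReesPrime_strictMono hg h).le) fun hle => ?_
        have := Ideal.comap_mono (f := ψ) (show (extendedReesPrime j q.asIdeal).map ψ ≤
          (extendedReesPrime j p.asIdeal).map ψ from hle)
        rw [hcomap, hcomap] at this
        exact (extendedReesPrime_strictMono hg h).not_ge this) ⟨m, inferInstance⟩
    rwa [← PrimeSpectrum.height_eq_orderHeight, ← PrimeSpectrum.height_eq_orderHeight] at h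
  refine hchain.trans (Ideal.height_le_height_of_specialization hψs hπ ?_ _ ?_ M ?_)
  · intro a ha
    rw [hker] at ha
    refine Ideal.dvd_map_of_mem_map g (ψ.comp C) ?_ ha
    intro a ha
    obtain ⟨b, hb⟩ := hI a ha
    refine ⟨ψ (C b), ?_⟩
    rw [← map_mul, RingHom.comp_apply]
    exact Ideal.Quotient.eq.mpr (sub_X_mul_mem_ker_extendedReesHom (hg a) hb)
  · rw [← Ideal.mem_comap, hcomap, mem_extendedReesPrime, extendedReesHom_X]
    intro h
    exact (Ideal.IsPrime.ne_top ‹_›) ((Ideal.eq_top_iff_one m).mpr (by simpa using h (-1)))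
  · rw [hcomap]
    intro f hf
    rw [mem_extendedReesPrime] at hf
    refine hM _ ?_
    have h1 := coeff_extendedReesHom_sub_mem hj hm f
    simpa using m.sub_mem (hf 0) h1

end ExtendedRees

/-! ### Independence over a polynomial ring acting through a regular sequence. -/

section RegularIndependence

open RingTheory.Sequence
open scoped Pointwise

variable {ι : Type*} [Fintype ι]

/-- Reducing a relation modulo `x` kills all constant coefficients. The remaining relation is
divisible by `x`, which may be cancelled, so the coefficients vanish one degree at a time. -/
lemma Polynomial.eq_zero_of_sum_eval₂_smul_eq_zero {C L M : Type*} [CommRing C] [CommRing L]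
    [AddCommGroup M] [Module L M] (φ : C →+* L) {x : L} (hx : IsSMulRegular M x) (f : ι → M)
    (hf : ∀ g : ι → C, ∑ i, φ (g i) • f i ∈ x • (⊤ : Submodule L M) → g = 0)
    (h : ι → Polynomial C) (hh : ∑ i, (h i).eval₂ φ x • f i = 0) : h = 0 := by
  have h1 : ∀ p : Polynomial C, p.eval₂ φ x = x * p.divX.eval₂ φ x + φ (p.coeff 0) := by
    intro p
    conv_lhs => rw [← Polynomial.X_mul_divX_add p]
    rw [Polynomial.eval₂_add, Polynomial.eval₂_mul, Polynomial.eval₂_X, Polynomial.eval₂_C]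
  have h0 : ∀ h : ι → Polynomial C, ∑ i, (h i).eval₂ φ x • f i = 0 → ∀ i, (h i).coeff 0 = 0 := by
    intro h hh i
    refine congrFun (hf (fun i => (h i).coeff 0) ?_) i
    simp only [fun i => h1 (h i), add_smul, Finset.sum_add_distrib, mul_smul, ← Finset.smul_sum] at hh
    rw [add_comm] at hh
    rw [eq_neg_of_add_eq_zero_left hh, ← smul_neg]
    exact Submodule.smul_mem_pointwise_smul _ _ _ Submodule.mem_top
  have key : ∀ (n : ℕ) (h : ι → Polynomial C), ∑ i, (h i).eval₂ φ x • f i = 0 →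
      ∀ i, (h i).coeff n = 0 := by
    intro n
    induction n with
    | zero => exact h0
    | succ n ih =>
      intro h hh i
      have h2 := h0 h hh
      simp only [fun i => h1 (h i), h2, map_zero, add_zero, mul_smul, ← Finset.smul_sum] at hh
      have h3 := ih (fun i => (h i).divX) (hx (by simpa using hh)) i
      simpa [Polynomial.coeff_divX] using h3
  funext i
  ext n
  simpa using key n h hh i

lemma MvPolynomial.aeval_eq_eval₂_finSuccEquiv {k L : Type*} [CommRing k] [CommRing L]
    [Algebra k L] {n : ℕ} (x : Fin (n + 1) → L) (p : MvPolynomial (Fin (n + 1)) k) :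
    aeval x p = (finSuccEquiv k n p).eval₂ (aeval (fun i => x i.succ)).toRingHom (x 0) := by
  induction p using MvPolynomial.induction_on with
  | C a => simp [finSuccEquiv_apply]
  | add p q hp hq => simp [hp, hq, Polynomial.eval₂_add]
  | mul_X p i hp =>
    rw [map_mul, map_mul, Polynomial.eval₂_mul, hp]
    congr 1
    refine Fin.cases ?_ (fun i => ?_) i
    · simp [finSuccEquiv_X_zero]
    · simp [finSuccEquiv_X_succ]

/-- Elements independent over `k` modulo a weakly regular sequence are independent over the
polynomial ring acting through that sequence. -/
lemma MvPolynomial.eq_zero_of_sum_aeval_smul_eq_zero {k L : Type*} [Field k] [CommRing L]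
    [Algebra k L] (n : ℕ) : ∀ {M : Type*} [AddCommGroup M] [Module L M] (x : Fin n → L)
    (_ : IsWeaklyRegular M (List.ofFn x)) (f : ι → M)
    (_ : ∀ c : ι → k, ∑ i, algebraMap k L (c i) • f i ∈
      (Ideal.ofList (List.ofFn x)) • (⊤ : Submodule L M) → c = 0)
    (g : ι → MvPolynomial (Fin n) k) (_ : ∑ i, aeval x (g i) • f i = 0), g = 0 := by
  induction n with
  | zero =>
    intro M _ _ x _ f hf g hg
    have h := hf (fun i => (isEmptyAlgEquiv k (Fin 0)) (g i)) (by
      convert Submodule.zero_mem _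
      rw [← hg]
      refine Finset.sum_congr rfl fun i _ => ?_
      congr 1
      conv_rhs => rw [← (isEmptyAlgEquiv k (Fin 0)).symm_apply_apply (g i)]
      simp)
    funext i
    exact (isEmptyAlgEquiv k (Fin 0)).injective ((congrFun h i).trans (map_zero _).symm)
  | succ n ih =>
    intro M _ _ x hx f hf g hg
    rw [List.ofFn_succ, isWeaklyRegular_cons_iff] at hx
    have h := Polynomial.eq_zero_of_sum_eval₂_smul_eq_zero
      (aeval (fun i : Fin n => x i.succ)).toRingHom hx.1 f ?_ (fun i => finSuccEquiv k n (g i)) ?_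
    · funext i
      have := congrFun h i
      simpa using this
    · intro g hg
      have hsum : ∀ c : ι → L, ∑ i, c i • (Submodule.Quotient.mk (f i) : QuotSMulTop (x 0) M) =
          Submodule.mkQ _ (∑ i, c i • f i) := by
        intro c
        simp [map_sum]
      -- The first variable has been split off; the others act on `M / x₀M`, where the tail of the
      -- sequence is still weakly regular.
      refine ih (fun i => x i.succ) hx.2 (fun i => Submodule.Quotient.mk (f i)) ?_ g ?_
      · intro c hc
        refine hf c ?_
        rw [List.ofFn_succ, Ideal.ofList_cons_smul]
        rw [hsum, ← Submodule.range_mkQ, ← Submodule.map_top, ← Submodule.map_smul''] at hc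
        obtain ⟨m, hm, hm'⟩ := hc
        rw [Submodule.mkQ_apply, Submodule.mkQ_apply, Submodule.Quotient.eq] at hm'
        rw [← sub_sub_cancel m (∑ i, algebraMap k L (c i) • f i)]
        exact Submodule.sub_mem _ (Submodule.mem_sup_right hm) (Submodule.mem_sup_left hm')
      · rw [hsum, Submodule.mkQ_apply, Submodule.Quotient.mk_eq_zero]
        exact hg
    · simpa only [aeval_eq_eval₂_finSuccEquiv] using hg

end RegularIndependence

/-! ### Standard graded algebras and linear parameters. -/

section StandardGraded

open DirectSum

variable {k B : Type*} [Field k] [CommRing B] [Algebra k B] {ℬ : ℕ → Submodule k B}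
  [GradedAlgebra ℬ]

namespace IsStandardGraded

lemma exists_sub_algebraMap_mem_irrelevant (hB : IsStandardGraded ℬ) (x : B) :
    ∃ c : k, x - algebraMap k B c ∈ (HomogeneousIdeal.irrelevant ℬ).toIdeal := by
  obtain ⟨c, hc⟩ := Submodule.mem_one.mp (hB.zero_eq.le (decompose ℬ x 0).2)
  refine ⟨c, ?_⟩
  rw [HomogeneousIdeal.mem_iff, HomogeneousIdeal.mem_irrelevant_iff, map_sub,
    GradedRing.proj_apply, GradedRing.proj_apply,
    decompose_of_mem_same ℬ (x := algebraMap k B c)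
      (by rw [hB.zero_eq]; exact Submodule.mem_one.mpr ⟨c, rfl⟩), hc, sub_self]

lemma isMaximal_irrelevant (hB : IsStandardGraded ℬ) :
    (HomogeneousIdeal.irrelevant ℬ).toIdeal.IsMaximal := by
  have := hB.nontrivial
  rw [Ideal.isMaximal_iff]
  refine ⟨?_, fun J x hJ hx hxJ => ?_⟩
  · rw [HomogeneousIdeal.mem_iff, HomogeneousIdeal.mem_irrelevant_iff, GradedRing.proj_apply,
      decompose_of_mem_same ℬ SetLike.GradedOne.one_mem]
    exact one_ne_zero
  · obtain ⟨c, hc⟩ := hB.exists_sub_algebraMap_mem_irrelevant x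
    have hc0 : c ≠ 0 := by
      rintro rfl
      exact hx (by simpa using hc)
    have h2 : algebraMap k B c ∈ J := by simpa using J.sub_mem hxJ (hJ hc)
    have h3 := J.mul_mem_left (algebraMap k B c⁻¹) h2
    rwa [← map_mul, inv_mul_cancel₀ hc0, map_one] at h3

lemma eq_zero_of_algebraMap_mem_irrelevant (hB : IsStandardGraded ℬ) {c : k}
    (hc : algebraMap k B c ∈ (HomogeneousIdeal.irrelevant ℬ).toIdeal) : c = 0 := by
  by_contra h0
  exact hB.isMaximal_irrelevant.ne_top
    (Ideal.eq_top_of_isUnit_mem _ hc ((IsUnit.mk0 c h0).map (algebraMap k B)))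

lemma finiteType (hB : IsStandardGraded ℬ) : Algebra.FiniteType k B := by
  classical
  have := hB.finite_one
  obtain ⟨n, s, hs⟩ := Module.Finite.exists_fin (R := k) (M := ℬ 1)
  refine ⟨⟨Finset.univ.image (fun i => (s i : B)), ?_⟩⟩
  rw [← top_le_iff, ← hB.adjoin_one, Algebra.adjoin_le_iff]
  intro x hx
  have h1 : (⟨x, hx⟩ : ℬ 1) ∈ Submodule.span k (Set.range s) := by rw [hs]; trivial
  have h2 := Submodule.mem_map_of_mem (f := (ℬ 1).subtype) h1
  rw [Submodule.map_span, ← Set.range_comp] at h2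
  have h3 := Algebra.span_le_adjoin k _ h2
  simpa [Function.comp_def] using h3

lemma isNoetherianRing (hB : IsStandardGraded ℬ) : IsNoetherianRing B := by
  have := hB.finiteType
  exact Algebra.FiniteType.isNoetherianRing k B

lemma irrelevant_le (hB : IsStandardGraded ℬ) {K : Ideal B} (hK : ∀ v ∈ ℬ 1, v ∈ K) :
    (HomogeneousIdeal.irrelevant ℬ).toIdeal ≤ K := by
  -- Every element is a scalar plus an element of `K`. Intersecting with the irrelevant ideal lets
  -- that scalar be identified as zero for elements without constant term.
  set K' := K ⊓ (HomogeneousIdeal.irrelevant ℬ).toIdeal with hK'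
  have key : ∀ x : B, ∃ c : k, x - algebraMap k B c ∈ K' := by
    intro x
    have hx : x ∈ Algebra.adjoin k (ℬ 1 : Set B) := by rw [hB.adjoin_one]; trivial
    induction hx using Algebra.adjoin_induction with
    | mem v hv =>
      exact ⟨0, by
        rw [map_zero, sub_zero]
        exact ⟨hK v hv, HomogeneousIdeal.mem_irrelevant_of_mem ℬ one_pos hv⟩⟩
    | algebraMap c => exact ⟨c, by rw [sub_self]; exact K'.zero_mem⟩
    | add x y _ _ hx hy =>
      obtain ⟨c, hc⟩ := hx
      obtain ⟨e, he⟩ := hy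
      exact ⟨c + e, by rw [map_add, add_sub_add_comm]; exact K'.add_mem hc he⟩
    | mul x y _ _ hx hy =>
      obtain ⟨c, hc⟩ := hx
      obtain ⟨e, he⟩ := hy
      refine ⟨c * e, ?_⟩
      have : x * y - algebraMap k B (c * e) =
          y * (x - algebraMap k B c) + algebraMap k B c * (y - algebraMap k B e) := by
        rw [map_mul]; ring
      rw [this]
      exact K'.add_mem (K'.mul_mem_left _ hc) (K'.mul_mem_left _ he)
  intro x hx
  obtain ⟨c, hc⟩ := key x
  have hc' : algebraMap k B c ∈ (HomogeneousIdeal.irrelevant ℬ).toIdeal := by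
    simpa using Ideal.sub_mem _ hx hc.2
  have hc0 := hB.eq_zero_of_algebraMap_mem_irrelevant hc'
  simpa [hc0] using hc.1

end IsStandardGraded

lemma MvPolynomial.aeval_mem_graded {σ : Type*} {a : σ → B}
    (ha : ∀ i, a i ∈ ℬ 1) {n : ℕ} {p : MvPolynomial σ k} (hp : p.IsHomogeneous n) :
    aeval a p ∈ ℬ n := by
  rw [aeval_def, eval₂_eq]
  refine Submodule.sum_mem _ fun d hd => ?_
  rw [← Algebra.smul_def]
  refine Submodule.smul_mem _ _ ?_
  have h := SetLike.prod_pow_mem_graded (A := ℬ) (fun _ => 1) a d (F := d.support)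
    (fun i _ => ha i)
  have hdeg := hp (MvPolynomial.mem_support_iff.mp hd)
  rw [Finsupp.weight_apply, Finsupp.sum] at hdeg
  rw [← hdeg]
  exact h

lemma MvPolynomial.aeval_homogeneousComponent_eq_zero {σ : Type*} {a : σ → B}
    (ha : ∀ i, a i ∈ ℬ 1) {p : MvPolynomial σ k} (hp : aeval a p = 0) (n : ℕ) :
    aeval a (homogeneousComponent n p) = 0 := by
  have h1 : GradedAlgebra.proj ℬ n (aeval a p) = aeval a (homogeneousComponent n p) := by
    conv_lhs => rw [← sum_homogeneousComponent p]
    rw [map_sum, map_sum]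
    have hi : ∀ i, aeval a (homogeneousComponent i p) ∈ ℬ i := fun i =>
      aeval_mem_graded ha (homogeneousComponent_isHomogeneous i p)
    by_cases hn : n ∈ Finset.range (p.totalDegree + 1)
    · rw [Finset.sum_eq_single_of_mem n hn, GradedAlgebra.proj_apply,
        decompose_of_mem_same ℬ (hi n)]
      intro i _ hin
      rw [GradedAlgebra.proj_apply, decompose_of_mem_ne ℬ (hi i) hin]
    · rw [Finset.sum_eq_zero, homogeneousComponent_eq_zero, map_zero]
      · simpa using hn
      · intro i hi'
        rw [GradedAlgebra.proj_apply, decompose_of_mem_ne ℬ (hi i)]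
        rintro rfl
        exact hn hi'
  rw [← h1, hp, map_zero]

lemma MvPolynomial.aeval_algebraMap_mul {σ C : Type*} [CommRing C] [Algebra k C] {n : ℕ}
    {p : MvPolynomial σ k} (hp : p.IsHomogeneous n) (c : σ → k) (z : C) :
    aeval (fun i => algebraMap k C (c i) * z) p = algebraMap k C (eval c p) * z ^ n := by
  rw [aeval_def, eval₂_eq, eval_eq, map_sum, Finset.sum_mul]
  refine Finset.sum_congr rfl fun d hd => ?_
  have hdeg := hp (MvPolynomial.mem_support_iff.mp hd)
  simp only [mul_pow, Finset.prod_mul_distrib, map_mul, map_prod, map_pow]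
  rw [Finset.prod_pow_eq_pow_sum]
  rw [Finsupp.weight_apply, Finsupp.sum] at hdeg
  simp only [Pi.one_apply, smul_eq_mul, mul_one] at hdeg
  rw [hdeg, mul_assoc]

/-- Replacing a homogeneous algebraically dependent sequence of linear forms by a shorter one that
generates an ideal with the same radical. -/
lemma exists_shorter_of_aeval_eq_zero [Infinite k] [Nontrivial B] {n : ℕ} {a : Fin n → B}
    (ha : ∀ i, a i ∈ ℬ 1) {p : MvPolynomial (Fin n) k} (hp0 : p ≠ 0)
    (hp : MvPolynomial.aeval a p = 0) :
    ∃ m < n, ∃ b : Fin m → B, (∀ i, b i ∈ ℬ 1) ∧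
      ∀ i, a i ∈ (Ideal.span (Set.range b)).radical := by
  obtain ⟨N, hN⟩ : ∃ N, MvPolynomial.homogeneousComponent N p ≠ 0 := by
    by_contra! h
    rw [← MvPolynomial.sum_homogeneousComponent p] at hp0
    exact hp0 (Finset.sum_eq_zero fun i _ => h i)
  have hpN := MvPolynomial.aeval_homogeneousComponent_eq_zero ha hp N
  have hhom := MvPolynomial.homogeneousComponent_isHomogeneous N p
  set f := MvPolynomial.homogeneousComponent N p with hf
  cases n with
  | zero =>
    exfalso
    apply hN
    rw [MvPolynomial.eq_C_of_isEmpty f] at hpN ⊢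
    rw [MvPolynomial.aeval_C, map_eq_zero_iff _ (algebraMap k B).injective] at hpN
    rw [hpN, map_zero]
  | succ m =>
    -- As `k` is infinite, some point has `f(c) ≠ 0` and `c 0 ≠ 0`. Modulo the new forms every `a i`
    -- becomes `c i · z`, so the relation reads `f(c) z ^ N = 0` and `z` is nilpotent.
    obtain ⟨c, hc⟩ : ∃ c : Fin (m + 1) → k, MvPolynomial.eval c (f * MvPolynomial.X 0) ≠ 0 := by
      by_contra! h
      refine mul_ne_zero hN (MvPolynomial.X_ne_zero 0) (MvPolynomial.funext fun c => ?_)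
      rw [h c, map_zero]
    rw [map_mul, MvPolynomial.eval_X, mul_ne_zero_iff] at hc
    obtain ⟨hfc, hc0⟩ := hc
    refine ⟨m, Nat.lt_succ_self m, fun i => a i.succ - (c i.succ / c 0) • a 0, fun i =>
      Submodule.sub_mem _ (ha _) (Submodule.smul_mem _ _ (ha _)), ?_⟩
    set J := Ideal.span (Set.range fun i : Fin m => a i.succ - (c i.succ / c 0) • a 0) with hJ
    set z : B ⧸ J := (c 0)⁻¹ • Ideal.Quotient.mk J (a 0) with hz
    have hai : ∀ i, Ideal.Quotient.mk J (a i) = algebraMap k (B ⧸ J) (c i) * z := by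
      intro i
      rw [hz, ← Algebra.smul_def, smul_smul]
      refine Fin.cases ?_ (fun i => ?_) i
      · rw [mul_inv_cancel₀ hc0, one_smul]
      · rw [← div_eq_mul_inv]
        exact Ideal.Quotient.eq.mpr (Ideal.subset_span ⟨i, rfl⟩)
    have h1 : MvPolynomial.aeval (fun i => Ideal.Quotient.mk J (a i)) f = 0 := by
      have := congrArg (Ideal.Quotient.mkₐ k J) hpN
      rw [map_zero, MvPolynomial.comp_aeval_apply] at this
      exact this
    simp only [hai] at h1
    rw [MvPolynomial.aeval_algebraMap_mul hhom, ← Algebra.smul_def, smul_eq_zero_iff_right hfc] at h1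
    intro i
    refine ⟨N, ?_⟩
    rw [← Ideal.Quotient.eq_zero_iff_mem, map_pow, hai, mul_pow, h1, mul_zero]

/-- Existence of a system of algebraically independent linear forms generating an ideal primary to
the irrelevant ideal. -/
lemma IsStandardGraded.exists_linear_parameters [Infinite k] (hB : IsStandardGraded ℬ) :
    ∃ (n : ℕ) (a : Fin n → B), (∀ i, a i ∈ ℬ 1) ∧ AlgebraicIndependent k a ∧
      ∀ v ∈ ℬ 1, v ∈ (Ideal.span (Set.range a)).radical := by
  classical
  have := hB.nontrivial
  have hex : ∃ (n : ℕ) (a : Fin n → B), (∀ i, a i ∈ ℬ 1) ∧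
      ∀ v ∈ ℬ 1, v ∈ (Ideal.span (Set.range a)).radical := by
    have := hB.finite_one
    obtain ⟨n, s, hs⟩ := Module.Finite.exists_fin (R := k) (M := ℬ 1)
    refine ⟨n, fun i => s i, fun i => (s i).2, fun v hv => Ideal.le_radical ?_⟩
    have h1 : (⟨v, hv⟩ : ℬ 1) ∈ Submodule.span k (Set.range s) := by rw [hs]; trivial
    have h2 := Submodule.mem_map_of_mem (f := (ℬ 1).subtype) h1
    rw [Submodule.map_span, ← Set.range_comp] at h2
    exact Submodule.span_le_restrictScalars k B _ h2
  -- With the number of forms minimal, an algebraic relation would produce a shorter family.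
  obtain ⟨a, ha, hrad⟩ := Nat.find_spec hex
  refine ⟨Nat.find hex, a, ha, ?_, hrad⟩
  rw [algebraicIndependent_iff]
  intro p hp
  by_contra hp0
  obtain ⟨m, hm, b, hb, hab⟩ := exists_shorter_of_aeval_eq_zero ha hp0 hp
  refine Nat.find_min hex hm ⟨b, hb, fun v hv => ?_⟩
  have hle : Ideal.span (Set.range a) ≤ (Ideal.span (Set.range b)).radical := by
    rw [Ideal.span_le]
    rintro _ ⟨i, rfl⟩
    exact hab i
  have := Ideal.radical_mono hle (hrad v hv)
  rwa [Ideal.radical_idem] at this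

end StandardGraded

/-! ### Partial systems of parameters at a Cohen-Macaulay prime. -/

open RingTheory.Sequence in
/-- In a Noetherian ring that is Cohen-Macaulay at the prime `M`, a sequence of elements of `M`
that is part of a system of parameters at `M` is weakly regular on the localization. -/
lemma isWeaklyRegular_localization_of_height_le {G Q : Type*} [CommRing G] [CommRing Q]
    [IsNoetherianRing G] {π : G →+* Q} (hπ : Function.Surjective π) {xs : List G}
    (hker : RingHom.ker π = Ideal.ofList xs) (P : Ideal Q) [P.IsPrime] (M : Ideal G) [M.IsPrime]
    (hM : P.comap π = M) (hht : (xs.length : ℕ∞) + P.height ≤ M.height)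
    (hCM : (localDepth (Localization.AtPrime M) : WithBot ℕ∞) =
      ringKrullDim (Localization.AtPrime M)) :
    IsWeaklyRegular (Localization.AtPrime M)
      (xs.map (algebraMap G (Localization.AtPrime M))) := by
  have : IsNoetherianRing Q := isNoetherianRing_of_surjective G Q π hπ
  have : IsNoetherianRing (Localization.AtPrime M) :=
    IsLocalization.isNoetherianRing M.primeCompl _ inferInstance
  -- Lifting `ht P` elements over which `P` is minimal completes `xs` to a full system of parameters
  -- at `M`.
  obtain ⟨s, hs, hcard⟩ := Ideal.exists_finset_card_eq_height_of_isNoetherianRing P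
  set ys : List G := s.toList.map (Function.surjInv hπ) with hys
  have hπys : ∀ y ∈ s, ∃ z ∈ ys, π z = y := fun y hy =>
    ⟨Function.surjInv hπ y, List.mem_map_of_mem (Finset.mem_toList.mpr hy),
      Function.surjInv_eq hπ y⟩
  have hlen : (((xs ++ ys).map (algebraMap G (Localization.AtPrime M))).length : ℕ∞) ≤
      M.height := by
    rw [List.length_map, List.length_append, hys, List.length_map, Finset.length_toList,
      Nat.cast_add, hcard]
    exact hht
  have hmem : ∀ r ∈ xs ++ ys, r ∈ M := by
    intro r hr
    rw [← hM, Ideal.mem_comap]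
    rcases List.mem_append.mp hr with hr | hr
    · have : r ∈ RingHom.ker π := by
        rw [hker]
        exact Ideal.subset_span hr
      rw [(RingHom.mem_ker).mp this]
      exact P.zero_mem
    · obtain ⟨y, hy, rfl⟩ := List.mem_map.mp hr
      rw [Function.surjInv_eq hπ]
      exact hs.1.2 (Ideal.subset_span (Finset.mem_toList.mp hy))
  have hmin : ∀ P' : Ideal G, P'.IsPrime → (∀ r ∈ xs ++ ys, r ∈ P') → P' ≤ M → P' = M := by
    intro P' hP' hr hle
    have hkle : RingHom.ker π ≤ P' := by
      rw [hker, Ideal.ofList, Ideal.span_le]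
      exact fun r h => hr r (List.mem_append_left _ h)
    have hprime : (P'.map π).IsPrime := Ideal.map_isPrime_of_surjective hπ hkle
    have h1 : P'.map π ≤ P := by
      rw [Ideal.map_le_iff_le_comap, hM]
      exact hle
    have h2 : P ≤ P'.map π := by
      refine hs.2 ⟨hprime, Ideal.span_le.mpr fun y hy => ?_⟩ h1
      obtain ⟨z, hz, rfl⟩ := hπys y hy
      exact Ideal.mem_map_of_mem _ (hr z (List.mem_append_right _ hz))
    refine le_antisymm hle ?_
    rw [← hM]
    refine (Ideal.comap_mono h2).trans ?_
    rw [Ideal.comap_map_of_surjective π hπ]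
    exact sup_le le_rfl hkle
  have key : IsWeaklyRegular (Localization.AtPrime M)
      ((xs ++ ys).map (algebraMap G (Localization.AtPrime M))) := by
    refine isWeaklyRegular_of_localDepth_eq_ringKrullDim hCM _ ?_ ?_ ?_
    · intro r hr
      obtain ⟨y, hy, rfl⟩ := List.mem_map.mp hr
      exact (IsLocalization.AtPrime.to_map_mem_maximal_iff _ M y).mpr (hmem y hy)
    · rw [IsLocalization.AtPrime.ringKrullDim_eq_height M]
      exact_mod_cast hlen
    · intro P' hP' hle
      have h1 : P'.comap (algebraMap G (Localization.AtPrime M)) = M := by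
        refine hmin _ inferInstance (fun r hr => hle (Ideal.subset_span ?_)) fun r hr => ?_
        · exact List.mem_map_of_mem hr
        · exact (IsLocalization.AtPrime.to_map_mem_maximal_iff (Localization.AtPrime M) M r).mp
            (IsLocalRing.le_maximalIdeal hP'.ne_top hr)
      rw [← IsLocalization.map_under M.primeCompl (Localization.AtPrime M) P', Ideal.under, h1,
        Localization.AtPrime.map_eq_maximalIdeal]
  rw [List.map_append, isWeaklyRegular_append_iff] at key
  exact key.1

/-! ### Freeness over the ring of linear parameters. -/

section StandardGraded

open DirectSum

variable {k B : Type*} [Field k] [CommRing B] [Algebra k B] {ℬ : ℕ → Submodule k B}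
  [GradedAlgebra ℬ]

/-- A graded form of Nakayama's lemma. -/
lemma eq_top_of_homogeneous_of_mul_mem {ι σ : Type*} [Fintype ι] [Fintype σ] {a : σ → B}
    (ha : ∀ i, a i ∈ ℬ 1) {f : ι → B} (hf : ∀ j, SetLike.IsHomogeneousElem ℬ (f j))
    (hspan : ∀ x, ∃ c : ι → k, x - ∑ j, c j • f j ∈ Ideal.span (Set.range a))
    {N : Submodule k B} (hfN : ∀ j, f j ∈ N) (haN : ∀ i, ∀ x ∈ N, x * a i ∈ N) : N = ⊤ := by
  classical
  -- Induction on the degree: the part of `b i * a i` in degree `e` is `a i` times the part of `b i`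
  -- in degree `e - 1`, and is zero when `e = 0`.
  have key : ∀ e, ∀ x ∈ ℬ e, x ∈ N := by
    intro e
    induction e using Nat.strong_induction_on with
    | _ e ih =>
      intro x hx
      obtain ⟨c, hc⟩ := hspan x
      obtain ⟨b, hb⟩ := Ideal.mem_span_range_iff_exists_fun.mp hc
      have hx' : x = ∑ j, c j • f j + ∑ i, b i * a i := by rw [hb]; abel
      have h1 : x = ∑ j, c j • GradedAlgebra.proj ℬ e (f j) +
          ∑ i, GradedAlgebra.proj ℬ e (b i * a i) := by
        have := congrArg (GradedAlgebra.proj ℬ e) hx'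
        rw [map_add, map_sum, map_sum, GradedAlgebra.proj_apply,
          decompose_of_mem_same ℬ hx] at this
        simpa only [map_smul] using this
      rw [h1]
      refine N.add_mem (N.sum_mem fun j _ => N.smul_mem _ ?_) (N.sum_mem fun i _ => ?_)
      · obtain ⟨m, hm⟩ := hf j
        rw [GradedAlgebra.proj_apply]
        by_cases hme : m = e
        · subst hme
          rw [decompose_of_mem_same ℬ hm]
          exact hfN j
        · rw [decompose_of_mem_ne ℬ hm hme]
          exact N.zero_mem
      · rw [GradedAlgebra.proj_apply, coe_decompose_mul_of_right_mem ℬ e (ha i)]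
        split_ifs with he
        · exact haN i _ (ih (e - 1) (by omega) _ (SetLike.coe_mem _))
        · exact N.zero_mem
  rw [eq_top_iff]
  intro x _
  rw [← sum_support_decompose ℬ x]
  exact N.sum_mem fun i _ => key i _ (SetLike.coe_mem _)

lemma span_aeval_eq_top {n m : ℕ} {a : Fin n → B} (ha : ∀ i, a i ∈ ℬ 1) {f : Fin m → B}
    (hf : ∀ j, SetLike.IsHomogeneousElem ℬ (f j))
    (hspan : ∀ x, ∃ c : Fin m → k, x - ∑ j, c j • f j ∈ Ideal.span (Set.range a)) :
    letI : Algebra (MvPolynomial (Fin n) k) B := (MvPolynomial.aeval (R := k) a).toRingHom.toAlgebra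
    Submodule.span (MvPolynomial (Fin n) k) (Set.range f) = ⊤ := by
  let _ : Algebra (MvPolynomial (Fin n) k) B := (MvPolynomial.aeval (R := k) a).toRingHom.toAlgebra
  have hsmul : ∀ (g : MvPolynomial (Fin n) k) (b : B), g • b = MvPolynomial.aeval a g * b :=
    fun _ _ => rfl
  have : IsScalarTower k (MvPolynomial (Fin n) k) B :=
    IsScalarTower.of_algebraMap_eq fun c => (MvPolynomial.aeval_C a c).symm
  refine (Submodule.restrictScalars_eq_top_iff k _ _).mp
    (eq_top_of_homogeneous_of_mul_mem ha hf hspan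
      (fun j => Submodule.subset_span ⟨j, rfl⟩) fun i x hx => ?_)
  have h := Submodule.smul_mem _ (MvPolynomial.X i : MvPolynomial (Fin n) k)
    ((Submodule.restrictScalars_mem k _ x).mp hx)
  rwa [hsmul, MvPolynomial.aeval_X, mul_comm] at h

namespace IsStandardGraded

/-- The linear generators become nilpotent, hence integral over `k`; a finitely generated integral
algebra is finite. -/
lemma finite_quotient (hB : IsStandardGraded ℬ) {J : Ideal B} (hJ : ∀ v ∈ ℬ 1, v ∈ J.radical) :
    Module.Finite k (B ⧸ J) := by
  have := hB.finiteType
  have hint : ∀ x : B, IsIntegral k (Ideal.Quotient.mkₐ k J x) := by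
    intro x
    have hx : x ∈ Algebra.adjoin k (ℬ 1 : Set B) := by rw [hB.adjoin_one]; trivial
    induction hx using Algebra.adjoin_induction with
    | mem v hv =>
      obtain ⟨N, hN⟩ := hJ v hv
      have h0 : (Ideal.Quotient.mkₐ k J v) ^ (N + 1) = 0 := by
        rw [← map_pow]
        exact Ideal.Quotient.eq_zero_iff_mem.mpr (by rw [pow_succ]; exact J.mul_mem_right _ hN)
      exact IsIntegral.of_pow (Nat.succ_pos N) (by rw [h0]; exact isIntegral_zero)
    | algebraMap c => rw [AlgHom.commutes]; exact isIntegral_algebraMap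
    | add x y _ _ hx hy => rw [map_add]; exact hx.add hy
    | mul x y _ _ hx hy => rw [map_mul]; exact hx.mul hy
  have : Algebra.IsIntegral k (B ⧸ J) := ⟨fun y => by
    obtain ⟨x, rfl⟩ := Ideal.Quotient.mk_surjective y
    exact hint x⟩
  exact Algebra.IsIntegral.finite

/-- Homogeneous elements lifting a basis of the quotient by an ideal primary to the irrelevant
ideal. -/
lemma exists_homogeneous_basis (hB : IsStandardGraded ℬ) {J : Ideal B}
    (hJ : ∀ v ∈ ℬ 1, v ∈ J.radical) :
    ∃ (m : ℕ) (f : Fin m → B), (∀ j, SetLike.IsHomogeneousElem ℬ (f j)) ∧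
      (∀ c : Fin m → k, ∑ j, c j • f j ∈ J → c = 0) ∧
      ∀ x, ∃ c : Fin m → k, x - ∑ j, c j • f j ∈ J := by
  classical
  have := hB.finite_quotient hJ
  obtain ⟨b, hbs, hspan, hli⟩ := exists_linearIndependent k
    (Ideal.Quotient.mkₐ k J '' {x | SetLike.IsHomogeneousElem ℬ x})
  have hfin : Finite b := hli.finite
  obtain ⟨m, ⟨e⟩⟩ := Finite.exists_equiv_fin b
  choose f hf hfb using fun j : Fin m => hbs (e.symm j).2
  have hmk : ∀ c : Fin m → k, Ideal.Quotient.mkₐ k J (∑ j, c j • f j) =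
      ∑ j, c j • (e.symm j : B ⧸ J) := fun c => by simp only [map_sum, map_smul, hfb]
  refine ⟨m, f, hf, fun c hc => ?_, fun x => ?_⟩
  · have hli' : LinearIndependent k fun j : Fin m => (e.symm j : B ⧸ J) :=
      hli.comp _ e.symm.injective
    refine funext (Fintype.linearIndependent_iff.mp hli' c ?_)
    rw [← hmk]
    exact Ideal.Quotient.eq_zero_iff_mem.mpr hc
  · have hx : Ideal.Quotient.mkₐ k J x ∈
        Submodule.span k (Set.range fun j : Fin m => (e.symm j : B ⧸ J)) := by
      have hr : (Set.range fun j : Fin m => (e.symm j : B ⧸ J)) = b := by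
        ext y
        exact ⟨by rintro ⟨j, rfl⟩; exact (e.symm j).2, fun hy => ⟨e ⟨y, hy⟩, by simp⟩⟩
      rw [hr, hspan, ← sum_support_decompose ℬ x, map_sum]
      exact Submodule.sum_mem _ fun i _ =>
        Submodule.subset_span ⟨_, ⟨i, SetLike.coe_mem _⟩, rfl⟩
    obtain ⟨c, hc⟩ := (Submodule.mem_span_range_iff_exists_fun k).mp hx
    refine ⟨c, Ideal.Quotient.eq.mp ?_⟩
    rw [← hmk] at hc
    exact hc.symm

/-- The radical of `J : x` contains the irrelevant maximal ideal and also `u`, so it is everything.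
-/
lemma mem_of_mul_mem (hB : IsStandardGraded ℬ) {J : Ideal B} (hJ : ∀ v ∈ ℬ 1, v ∈ J.radical)
    {u x : B} (hu : u ∉ (HomogeneousIdeal.irrelevant ℬ).toIdeal) (hux : u * x ∈ J) : x ∈ J := by
  set K : Ideal B := J.colon {x} with hK
  have hmemK : ∀ y, y ∈ K ↔ y * x ∈ J := fun y => Submodule.mem_colon_singleton
  have hJK : J ≤ K := fun y hy => (hmemK y).mpr (J.mul_mem_right _ hy)
  have hle := hB.irrelevant_le fun v hv => Ideal.radical_mono hJK (hJ v hv)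
  have htop : K.radical = ⊤ := by
    by_contra hne
    rw [hB.isMaximal_irrelevant.eq_of_le hne hle] at hu
    exact hu (Ideal.le_radical ((hmemK u).mpr hux))
  rw [Ideal.radical_eq_top] at htop
  simpa using (hmemK 1).mp (htop ▸ Submodule.mem_top)

open RingTheory.Sequence in
/-- Let `B` be a standard graded algebra that is an algebra retract of a ring `G`. If a linear
system of parameters of `B` is weakly regular on the localization of `G` at the contraction of the
irrelevant ideal, then `B` is finite and flat over the polynomial ring in these parameters. -/
lemma finite_flat_aeval_of_retract (hB : IsStandardGraded ℬ) {n : ℕ} {a : Fin n → B}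
    (ha : ∀ i, a i ∈ ℬ 1) (hrad : ∀ v ∈ ℬ 1, v ∈ (Ideal.span (Set.range a)).radical)
    {G : Type*} [CommRing G] (σ : B →+* G) (q : G →+* B) (hq : ∀ b, q (σ b) = b)
    (M : Ideal G) [M.IsPrime] (hM : (HomogeneousIdeal.irrelevant ℬ).toIdeal.comap q = M)
    (hreg : IsWeaklyRegular (Localization.AtPrime M)
      (List.ofFn fun i => algebraMap G (Localization.AtPrime M) (σ (a i)))) :
    (MvPolynomial.aeval (R := k) a).toRingHom.Finite ∧
      (MvPolynomial.aeval (R := k) a).toRingHom.Flat := by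
  obtain ⟨m, f, hf, hli, hspan⟩ := hB.exists_homogeneous_basis hrad
  let _ : Algebra (MvPolynomial (Fin n) k) B := (MvPolynomial.aeval (R := k) a).toRingHom.toAlgebra
  have hsmul : ∀ (g : MvPolynomial (Fin n) k) (b : B), g • b = MvPolynomial.aeval a g * b :=
    fun _ _ => rfl
  have htop := span_aeval_eq_top ha hf hspan
  have hind : LinearIndependent (MvPolynomial (Fin n) k) f := by
    rw [Fintype.linearIndependent_iff]
    intro g hg
    let τ : B →+* Localization.AtPrime M := (algebraMap G (Localization.AtPrime M)).comp σ
    let _ : Algebra k (Localization.AtPrime M) := (τ.comp (algebraMap k B)).toAlgebra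
    let τ' : B →ₐ[k] Localization.AtPrime M := { τ with commutes' := fun _ => rfl }
    refine congrFun (MvPolynomial.eq_zero_of_sum_aeval_smul_eq_zero n (fun i => τ' (a i)) hreg
      (fun j => τ' (f j)) (fun c hc => ?_) g ?_)
    · apply hli
      have hsum : ∑ j, algebraMap k (Localization.AtPrime M) (c j) • τ' (f j) =
          algebraMap G (Localization.AtPrime M) (σ (∑ j, c j • f j)) := by
        have : ∑ j, algebraMap k (Localization.AtPrime M) (c j) • τ' (f j) =
            τ' (∑ j, c j • f j) := by
          simp only [map_sum, Algebra.smul_def, map_mul, AlgHom.commutes, Algebra.algebraMap_self,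
            RingHom.id_apply]
        exact this
      have hid : Ideal.ofList (List.ofFn fun i => τ' (a i)) =
          (Ideal.span (Set.range fun i => σ (a i))).map
            (algebraMap G (Localization.AtPrime M)) := by
        rw [Ideal.map_span, Ideal.ofList, ← Set.range_comp]
        congr 1
        ext y
        simp only [List.mem_ofFn]
        rfl
      rw [hsum, hid, smul_eq_mul, Ideal.mul_top,
        IsLocalization.algebraMap_mem_map_algebraMap_iff M.primeCompl] at hc
      obtain ⟨u, hu, hux⟩ := hc
      -- The retraction carries the membership from `G` back to `B`, where the denominator `q u`
      -- lies outside the irrelevant ideal and can be removed.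
      have h1 := Ideal.mem_map_of_mem q hux
      rw [map_mul, hq, Ideal.map_span, ← Set.range_comp] at h1
      simp only [Function.comp_def, hq] at h1
      refine hB.mem_of_mul_mem hrad (fun h => hu ?_) h1
      rw [← hM]
      exact h
    · have h1 := congrArg τ' hg
      rw [map_sum, map_zero] at h1
      rw [← h1]
      refine Finset.sum_congr rfl fun j _ => ?_
      rw [hsmul, map_mul, MvPolynomial.comp_aeval_apply, smul_eq_mul]
  have hbasis := Module.Basis.mk hind htop.ge
  have : Module.Free (MvPolynomial (Fin n) k) B := Module.Free.of_basis hbasis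
  have hfin : Module.Finite (MvPolynomial (Fin n) k) B := Module.Finite.of_basis hbasis
  exact ⟨hfin, (inferInstance : Module.Flat (MvPolynomial (Fin n) k) B)⟩

/-- The number of linear parameters is the Krull dimension. -/
lemma ringKrullDim_eq (hB : IsStandardGraded ℬ) {n : ℕ} {a : Fin n → B} (ha : ∀ i, a i ∈ ℬ 1)
    (hind : AlgebraicIndependent k a)
    (hrad : ∀ v ∈ ℬ 1, v ∈ (Ideal.span (Set.range a)).radical) : ringKrullDim B = n := by
  obtain ⟨m, f, hf, -, hspan⟩ := hB.exists_homogeneous_basis hrad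
  let _ : Algebra (MvPolynomial (Fin n) k) B := (MvPolynomial.aeval (R := k) a).toRingHom.toAlgebra
  have htop := span_aeval_eq_top ha hf hspan
  have hfin : Module.Finite (MvPolynomial (Fin n) k) B :=
    Module.finite_def.mpr (Submodule.fg_def.mpr ⟨_, Set.finite_range f, htop⟩)
  have hdim : ringKrullDim (MvPolynomial (Fin n) k) = n := by
    rw [MvPolynomial.ringKrullDim_of_isNoetherianRing, ringKrullDim_eq_zero_of_field]
    simp
  rw [← hdim]
  exact le_antisymm (ringKrullDim_le_of_isIntegral _ _)
    (ringKrullDim_le_of_isIntegral_of_injective _ _ hind)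

end IsStandardGraded

end StandardGraded

open Polynomial

/-! ### The algebra `k[Vt]` and its grading. -/

section FiberAlgebra

variable {k R : Type*} [Field k] [CommRing R] [Algebra k R]

/-- The subalgebra of `R[X]` generated over `k` by the monomials `v X` with `v` in a subspace `V`
of `R`. -/
noncomputable abbrev fiberAlgebra (V : Submodule k R) : Subalgebra k R[X] :=
  Algebra.adjoin k ((fun v => monomial 1 v) '' (V : Set R))

lemma fiberAlgebra.coeff_mem_pow {V : Submodule k R} {b : R[X]} (hb : b ∈ fiberAlgebra V) (n : ℕ) :
    b.coeff n ∈ V ^ n := by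
  induction hb using Algebra.adjoin_induction generalizing n with
  | mem x hx =>
    obtain ⟨v, hv, rfl⟩ := hx
    rw [coeff_monomial]
    split_ifs with h
    · rw [← h, pow_one]
      exact hv
    · exact zero_mem _
  | algebraMap c =>
    rw [Polynomial.algebraMap_apply, coeff_C]
    split_ifs with h
    · rw [h, pow_zero]
      exact Submodule.mem_one.mpr ⟨c, rfl⟩
    · exact zero_mem _
  | add x y _ _ hx hy =>
    rw [coeff_add]
    exact add_mem (hx n) (hy n)
  | mul x y _ _ hx hy =>
    rw [coeff_mul]
    refine sum_mem fun p hp => ?_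
    rw [← Finset.HasAntidiagonal.mem_antidiagonal.mp hp, pow_add]
    exact Submodule.mul_mem_mul (hx _) (hy _)

lemma fiberAlgebra.monomial_mem {V : Submodule k R} {n : ℕ} {r : R} (hr : r ∈ V ^ n) :
    monomial n r ∈ fiberAlgebra V := by
  induction hr using Submodule.pow_induction_on_left' with
  | algebraMap c =>
    rw [monomial_zero_left, ← Polynomial.algebraMap_apply]
    exact Subalgebra.algebraMap_mem _ c
  | add x y i _ _ hx hy =>
    rw [map_add]
    exact add_mem hx hy
  | mem_mul v hv i x _ hx =>
    rw [Nat.succ_eq_one_add, ← monomial_mul_monomial]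
    exact mul_mem (Algebra.subset_adjoin ⟨v, hv, rfl⟩) hx

/-- The degree `n` part of `fiberAlgebra V`. -/
noncomputable def fiberAlgebra.grading (V : Submodule k R) (n : ℕ) : Submodule k (fiberAlgebra V) :=
  (LinearMap.range ((monomial n : R →ₗ[R] R[X]).restrictScalars k)).comap
    (fiberAlgebra V).val.toLinearMap

lemma fiberAlgebra.mem_grading {V : Submodule k R} {n : ℕ} {b : fiberAlgebra V} :
    b ∈ grading V n ↔ ∃ r, monomial n r = (b : R[X]) := Iff.rfl

lemma fiberAlgebra.isInternal_grading (V : Submodule k R) :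
    DirectSum.IsInternal (grading V) := by
  rw [DirectSum.isInternal_submodule_iff_iSupIndep_and_iSup_eq_top]
  constructor
  · intro n
    rw [Submodule.disjoint_def]
    intro x hx hx'
    have hle : ⨆ j, ⨆ _ : j ≠ n, grading V j ≤
        LinearMap.ker (((lcoeff R n).restrictScalars k).comp (fiberAlgebra V).val.toLinearMap) := by
      refine iSup₂_le fun j hj b hb => ?_
      obtain ⟨r, hr⟩ := mem_grading.mp hb
      change (b : R[X]).coeff n = 0
      rw [← hr]
      exact coeff_monomial_of_ne _ hj.symm
    have h0 : (x : R[X]).coeff n = 0 := hle hx'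
    obtain ⟨r, hr⟩ := mem_grading.mp hx
    rw [← hr, coeff_monomial_same] at h0
    rw [h0, monomial_zero_right] at hr
    exact Subtype.ext hr.symm
  · rw [eq_top_iff]
    intro b _
    have hb : b = ∑ n ∈ (b : R[X]).support,
        ⟨monomial n ((b : R[X]).coeff n), monomial_mem (coeff_mem_pow b.2 n)⟩ := by
      apply Subtype.ext
      rw [AddSubmonoidClass.coe_finsetSum]
      exact (b : R[X]).as_sum_support
    rw [hb]
    exact sum_mem fun n _ => Submodule.mem_iSup_of_mem n ⟨_, rfl⟩

noncomputable instance fiberAlgebra.gradedAlgebra (V : Submodule k R) :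
    GradedAlgebra (grading V) where
  __ := (isInternal_grading V).chooseDecomposition
  one_mem := ⟨1, rfl⟩
  mul_mem := by
    rintro i j x y ⟨r, hr⟩ ⟨s, hs⟩
    refine mem_grading.mpr ⟨r * s, ?_⟩
    rw [← monomial_mul_monomial]
    exact congrArg₂ (· * ·) hr hs

lemma fiberAlgebra.isStandardGraded [Nontrivial R] {V : Submodule k R} (hV : V.FG) :
    IsStandardGraded (grading V) where
  nontrivial := inferInstance
  zero_eq := by
    apply le_antisymm
    · intro b hb
      obtain ⟨r, hr⟩ := mem_grading.mp hb
      have h := coeff_mem_pow b.2 0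
      rw [← hr, coeff_monomial_same, pow_zero] at h
      obtain ⟨c, rfl⟩ := Submodule.mem_one.mp h
      exact Submodule.mem_one.mpr ⟨c, Subtype.ext hr⟩
    · rw [Submodule.one_le]
      exact SetLike.GradedOne.one_mem
  finite_one := by
    have : Module.Finite k V := Module.Finite.iff_fg.mpr hV
    let φ : V →ₗ[k] grading V 1 :=
      { toFun := fun v => ⟨⟨monomial 1 (v : R), Algebra.subset_adjoin ⟨v, v.2, rfl⟩⟩, ⟨v, rfl⟩⟩
        map_add' := fun v w => Subtype.ext (Subtype.ext (map_add (monomial 1) _ _))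
        map_smul' := fun c v => Subtype.ext (Subtype.ext (smul_monomial _ _ _).symm) }
    refine Module.Finite.of_surjective φ fun b => ?_
    obtain ⟨r, hr⟩ := mem_grading.mp b.2
    have h := coeff_mem_pow (b : fiberAlgebra V).2 1
    rw [← hr, coeff_monomial_same, pow_one] at h
    exact ⟨⟨r, h⟩, Subtype.ext (Subtype.ext hr)⟩
  adjoin_one := by
    rw [eq_top_iff, ← Algebra.adjoin_adjoin_coe_preimage]
    refine Algebra.adjoin_mono ?_
    rintro b ⟨v, -, hv⟩
    exact ⟨v, hv⟩

lemma fiberAlgebra.mem_irrelevant_iff {V : Submodule k R} {b : fiberAlgebra V} :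
    b ∈ (HomogeneousIdeal.irrelevant (grading V)).toIdeal ↔ (b : R[X]).coeff 0 = 0 := by
  classical
  rw [HomogeneousIdeal.mem_iff, HomogeneousIdeal.mem_irrelevant_iff, GradedRing.proj_apply]
  obtain ⟨r, hr⟩ := mem_grading.mp (DirectSum.decompose (grading V) b 0).2
  have hcoeff : (b : R[X]).coeff 0 = r := by
    have h := congrArg (fun b : fiberAlgebra V => (b : R[X]).coeff 0)
      (DirectSum.sum_support_decompose (grading V) b)
    simp only [AddSubmonoidClass.coe_finsetSum, finsetSum_coeff] at h
    rw [← h, Finset.sum_eq_single 0, ← hr, coeff_monomial_same]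
    · intro i _ hi
      obtain ⟨s, hs⟩ := mem_grading.mp (DirectSum.decompose (grading V) b i).2
      rw [← hs, coeff_monomial_of_ne _ hi.symm]
    · intro h0
      rw [DFinsupp.notMem_support_iff.mp h0]
      simp
  rw [hcoeff]
  constructor
  · intro h
    rw [h] at hr
    simpa using hr
  · rintro rfl
    exact Subtype.ext (by rw [← hr, monomial_zero_right]; rfl)

end FiberAlgebra

/-! ### Ideals generated in high degrees. -/

section GradedOrder

open DirectSum

variable {k R : Type*} [Field k] [CommRing R] [Algebra k R] (𝒜 : ℕ → Submodule k R)

/-- The ideal generated by the forms of degree at least `m`. -/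
def idealOfDegreeGE (m : ℕ) : Ideal R :=
  Ideal.span {x | ∃ e, m ≤ e ∧ x ∈ 𝒜 e}

lemma mem_idealOfDegreeGE {m : ℕ} {x : R} (hx : x ∈ 𝒜 m) : x ∈ idealOfDegreeGE 𝒜 m :=
  Ideal.subset_span ⟨m, le_rfl, hx⟩

variable [GradedAlgebra 𝒜]

lemma idealOfDegreeGE_mul_le (m n : ℕ) :
    idealOfDegreeGE 𝒜 m * idealOfDegreeGE 𝒜 n ≤ idealOfDegreeGE 𝒜 (m + n) := by
  rw [idealOfDegreeGE, idealOfDegreeGE, Ideal.span_mul_span', Ideal.span_le]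
  rintro _ ⟨x, ⟨i, hi, hx⟩, y, ⟨j, hj, hy⟩, rfl⟩
  exact Ideal.subset_span ⟨i + j, add_le_add hi hj, SetLike.GradedMul.mul_mem hx hy⟩

lemma pow_le_idealOfDegreeGE {I : Ideal R} {d : ℕ} (hI : I ≤ idealOfDegreeGE 𝒜 d) (n : ℕ) :
    I ^ n ≤ idealOfDegreeGE 𝒜 (n * d) := by
  induction n with
  | zero =>
    rw [zero_mul]
    exact le_top.trans ((Ideal.eq_top_iff_one _).mpr
      (mem_idealOfDegreeGE 𝒜 SetLike.GradedOne.one_mem)).ge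
  | succ n ih =>
    rw [pow_succ, Nat.succ_mul]
    exact (Ideal.mul_mono ih hI).trans (idealOfDegreeGE_mul_le 𝒜 _ _)

lemma eq_zero_of_mem_idealOfDegreeGE {m e : ℕ} (he : e < m) {x : R}
    (hx : x ∈ idealOfDegreeGE 𝒜 m) (hxe : x ∈ 𝒜 e) : x = 0 := by
  have key : ∀ x ∈ idealOfDegreeGE 𝒜 m, ∀ r, GradedAlgebra.proj 𝒜 e (r * x) = 0 := by
    intro x hx
    induction hx using Submodule.span_induction with
    | mem x hx =>
      obtain ⟨i, hi, hx⟩ := hx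
      intro r
      rw [GradedAlgebra.proj_apply, coe_decompose_mul_of_right_mem 𝒜 e hx, if_neg (by omega)]
    | zero => intro r; rw [mul_zero, map_zero]
    | add x y _ _ hx hy => intro r; rw [mul_add, map_add, hx, hy, add_zero]
    | smul a x _ hx => intro r; rw [smul_eq_mul, ← mul_assoc, hx]
  have h := key x hx 1
  rwa [one_mul, GradedAlgebra.proj_apply, decompose_of_mem_same 𝒜 hxe] at h

end GradedOrder

/-! ### Generators, coefficients and integral quotients of the Rees algebra. -/

section Rees

variable {R : Type*} [CommRing R] {I : Ideal R}

lemma reesAlgebra.monomial_one_mem {r : R} (hr : r ∈ I) : monomial 1 r ∈ reesAlgebra I :=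
  reesAlgebra.monomial_mem.mpr (by rwa [pow_one])

lemma reesAlgebra.induction_on_generators {V : Set R} (hV : Ideal.span V = I)
    {P : reesAlgebra I → Prop} (hC : ∀ r, P (algebraMap R (reesAlgebra I) r))
    (hX : ∀ v (hv : v ∈ V), P ⟨monomial 1 v, monomial_one_mem (hV ▸ Ideal.subset_span hv)⟩)
    (hadd : ∀ x y, P x → P y → P (x + y)) (hmul : ∀ x y, P x → P y → P (x * y))
    (y : reesAlgebra I) : P y := by
  have key : ∀ p ∈ reesAlgebra I, ∃ h : p ∈ reesAlgebra I, P ⟨p, h⟩ := by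
    intro p hp
    rw [← adjoin_monomial_eq_reesAlgebra] at hp
    induction hp using Algebra.adjoin_induction with
    | mem x hx =>
      obtain ⟨r, hr, rfl⟩ := hx
      rw [← hV, ← Ideal.submodule_span_eq] at hr
      induction hr using Submodule.span_induction with
      | mem v hv => exact ⟨_, hX v hv⟩
      | zero =>
        refine ⟨by rw [map_zero]; exact zero_mem _, ?_⟩
        convert hC 0
        rw [map_zero, map_zero]
        rfl
      | add v w _ _ hv hw =>
        obtain ⟨h1, hv⟩ := hv
        obtain ⟨h2, hw⟩ := hw
        refine ⟨by rw [map_add]; exact add_mem h1 h2, ?_⟩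
        convert hadd _ _ hv hw
        rw [map_add]
        rfl
      | smul a v _ hv =>
        obtain ⟨h1, hv⟩ := hv
        refine ⟨by rw [map_smul]; exact Subalgebra.smul_mem _ h1 a, ?_⟩
        convert hmul _ _ (hC a) hv
        rw [map_smul, ← Algebra.smul_def]
        rfl
    | algebraMap r => exact ⟨Subalgebra.algebraMap_mem _ r, hC r⟩
    | add x y _ _ hx hy =>
      obtain ⟨h1, hx⟩ := hx
      obtain ⟨h2, hy⟩ := hy
      exact ⟨add_mem h1 h2, hadd _ _ hx hy⟩
    | mul x y _ _ hx hy =>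
      obtain ⟨h1, hx⟩ := hx
      obtain ⟨h2, hy⟩ := hy
      exact ⟨mul_mem h1 h2, hmul _ _ hx hy⟩
  exact (key y y.2).2

lemma reesAlgebra.coeff_mem_of_mem_map (𝔪 : Ideal R) {y : reesAlgebra I}
    (hy : y ∈ 𝔪.map (algebraMap R (reesAlgebra I))) (n : ℕ) :
    (y : R[X]).coeff n ∈ 𝔪 * I ^ n := by
  induction hy using Submodule.span_induction generalizing n with
  | mem x hx =>
    obtain ⟨r, hr, rfl⟩ := hx
    change (C r).coeff n ∈ _
    rw [coeff_C]
    split_ifs with h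
    · rw [h, pow_zero, mul_one]
      exact hr
    · exact zero_mem _
  | zero => exact zero_mem _
  | add x y _ _ hx hy => exact add_mem (hx n) (hy n)
  | smul a x _ hx =>
    change ((a : R[X]) * (x : R[X])).coeff n ∈ _
    rw [coeff_mul]
    refine sum_mem fun p hp => ?_
    have h := Ideal.mul_mem_mul ((mem_reesAlgebra_iff _ _).mp a.2 p.1) (hx p.2)
    rwa [mul_left_comm, ← pow_add, Finset.HasAntidiagonal.mem_antidiagonal.mp hp] at h

/-- A quotient of the Rees algebra in which the degree one generators become nilpotent is integral
over the base ring. -/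
lemma reesAlgebra.isIntegral_comp_algebraMap {V : Set R} (hV : Ideal.span V = I) {Q : Type*}
    [CommRing Q] {φ : reesAlgebra I →+* Q} (hφ : Function.Surjective φ)
    (hnil : ∀ v (hv : v ∈ V),
      IsNilpotent (φ ⟨monomial 1 v, monomial_one_mem (hV ▸ Ideal.subset_span hv)⟩)) :
    (φ.comp (algebraMap R (reesAlgebra I))).IsIntegral := by
  intro y
  obtain ⟨x, rfl⟩ := hφ y
  induction x using reesAlgebra.induction_on_generators hV with
  | hC r => exact RingHom.isIntegralElem_map _ (x := r)
  | hX v hv =>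
    obtain ⟨N, hN⟩ := hnil v hv
    let _ := (φ.comp (algebraMap R (reesAlgebra I))).toAlgebra
    have h0 : (φ ⟨monomial 1 v, monomial_one_mem (hV ▸ Ideal.subset_span hv)⟩) ^ (N + 1) = 0 := by
      rw [pow_succ, hN, zero_mul]
    exact IsIntegral.of_pow (R := R) (Nat.succ_pos N) (by rw [h0]; exact isIntegral_zero)
  | hadd x y hx hy => rw [map_add]; exact hx.add _ hy
  | hmul x y hx hy => rw [map_mul]; exact hx.mul _ hy

end Rees

/-! ### The fiber algebra as special fiber and as retract of the associated graded ring. -/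

section FiberAlgebra

variable {k R : Type*} [Field k] [CommRing R] [Algebra k R] {V : Submodule k R} {I : Ideal R}

/-- The inclusion of `fiberAlgebra V` in the Rees algebra of the ideal generated by `V`. -/
noncomputable def fiberAlgebra.toRees (hV : Ideal.span (V : Set R) = I) :
    fiberAlgebra V →+* reesAlgebra I :=
  (fiberAlgebra V).val.toRingHom.codRestrict (reesAlgebra I) fun b => by
    rw [mem_reesAlgebra_iff]
    intro n
    have hle : ∀ n, ∀ x ∈ V ^ n, x ∈ I ^ n := by
      intro n x hx
      induction hx using Submodule.pow_induction_on_left' with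
      | algebraMap c => rw [pow_zero, Ideal.one_eq_top]; trivial
      | add x y i _ _ hx hy => exact add_mem hx hy
      | mem_mul v hv i x _ hx =>
        rw [pow_succ']
        exact Ideal.mul_mem_mul (hV ▸ Ideal.subset_span hv) hx
    exact hle n _ (coeff_mem_pow b.2 n)

@[simp]
lemma fiberAlgebra.coe_toRees (hV : Ideal.span (V : Set R) = I) (b : fiberAlgebra V) :
    (toRees hV b : R[X]) = b := rfl

/-- If `gr_I(R)` is Cohen-Macaulay and retracts onto the fiber algebra, then the fiber algebra is
finite and flat over the polynomial ring in `n = ht I` linear parameters. -/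
lemma fiberAlgebra.finite_flat_aeval [Nontrivial R] [IsNoetherianRing R]
    (hV : Ideal.span (V : Set R) = I) (hfg : V.FG) {𝔪 : Ideal R} [h𝔪 : 𝔪.IsMaximal] (hI : I ≤ 𝔪)
    {G : Type*} [CommRing G] {π : reesAlgebra I →+* G} (hπ : Function.Surjective π)
    (hker : RingHom.ker π = I.map (algebraMap R (reesAlgebra I))) (hG : IsCohenMacaulayRing G)
    {q : G →+* fiberAlgebra V} (hq : ∀ b, q (π (toRees hV b)) = b)
    (hqM : ∀ x : reesAlgebra I, (x : R[X]).coeff 0 ∈ 𝔪 →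
      q (π x) ∈ (HomogeneousIdeal.irrelevant (grading V)).toIdeal)
    {n : ℕ} (hn : I.height = n) {a : Fin n → fiberAlgebra V} (ha : ∀ i, a i ∈ grading V 1)
    (hrad : ∀ v ∈ grading V 1, v ∈ (Ideal.span (Set.range a)).radical) :
    (MvPolynomial.aeval (R := k) a).toRingHom.Finite ∧
      (MvPolynomial.aeval (R := k) a).toRingHom.Flat := by
  have hB := isStandardGraded hfg
  have := hG.isNoetherianRing
  have hB_max := hB.isMaximal_irrelevant
  have hqs : Function.Surjective q := fun b => ⟨_, hq b⟩
  set M := (HomogeneousIdeal.irrelevant (grading V)).toIdeal.comap q with hM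
  have hM_max : M.IsMaximal := Ideal.comap_isMaximal_of_surjective q hqs
  refine hB.finite_flat_aeval_of_retract ha hrad (π.comp (toRees hV)) q hq M rfl ?_
  set xs : List G := List.ofFn fun i => π (toRees hV (a i)) with hxs
  have hxM : ∀ i, π (toRees hV (a i)) ∈ M := fun i => by
    rw [hM, Ideal.mem_comap, hq]
    exact HomogeneousIdeal.mem_irrelevant_of_mem _ one_pos (ha i)
  have hJ : Ideal.ofList xs = Ideal.span (Set.range fun i => π (toRees hV (a i))) := by
    rw [Ideal.ofList]
    congr 1
    ext y
    simp [hxs, List.mem_ofFn]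
  set ψ := Ideal.Quotient.mk (Ideal.ofList xs) with hψ
  have hψs : Function.Surjective ψ := Ideal.Quotient.mk_surjective
  have hψker : RingHom.ker ψ = Ideal.ofList xs := Ideal.mk_ker
  have hkle : RingHom.ker ψ ≤ M := by
    rw [hψker, hJ, Ideal.span_le]
    rintro _ ⟨i, rfl⟩
    exact hxM i
  have hP : (M.map ψ).IsPrime := Ideal.map_isPrime_of_surjective hψs hkle
  have hcomap : (M.map ψ).comap ψ = M := by
    rw [Ideal.comap_map_of_surjective ψ hψs]
    exact sup_eq_left.mpr hkle
  -- Powers of the elements `vt` lie in the ideal of the parameters, so this quotient of `G` is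
  -- integral over `R`. The image of `M` contracts to `𝔪`, whose height is at most that of `M`.
  have hht : I.height + (M.map ψ).height ≤ M.height := by
    let _ : Algebra R (G ⧸ Ideal.ofList xs) :=
      ((ψ.comp π).comp (algebraMap R (reesAlgebra I))).toAlgebra
    have hint : Algebra.IsIntegral R (G ⧸ Ideal.ofList xs) := by
      refine ⟨reesAlgebra.isIntegral_comp_algebraMap hV (φ := ψ.comp π) (hψs.comp hπ) ?_⟩
      intro v hv
      let w : fiberAlgebra V := ⟨monomial 1 v, Algebra.subset_adjoin ⟨v, hv, rfl⟩⟩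
      obtain ⟨N, hN⟩ := hrad w ⟨v, rfl⟩
      refine ⟨N, ?_⟩
      have h1 := Ideal.mem_map_of_mem (π.comp (toRees hV)) hN
      rw [Ideal.map_span, ← Set.range_comp, map_pow] at h1
      have h2 : (π (toRees hV w)) ^ N ∈ RingHom.ker ψ := by
        rw [hψker, hJ]
        exact h1
      rw [RingHom.mem_ker, map_pow] at h2
      exact h2
    have hIker : I ≤ RingHom.ker (algebraMap R (G ⧸ Ideal.ofList xs)) := by
      intro r hr
      have h1 : algebraMap R (reesAlgebra I) r ∈ RingHom.ker π := by
        rw [hker]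
        exact Ideal.mem_map_of_mem _ hr
      change ψ (π (algebraMap R (reesAlgebra I) r)) = 0
      rw [(RingHom.mem_ker).mp h1, map_zero]
    have hcomap' : (M.map ψ).comap (algebraMap R (G ⧸ Ideal.ofList xs)) = 𝔪 := by
      refine (h𝔪.eq_of_le (Ideal.comap_ne_top _ hP.ne_top) fun r hr => ?_).symm
      refine Ideal.mem_comap.mpr (Ideal.mem_map_of_mem ψ
        (x := π (algebraMap R (reesAlgebra I) r)) (hqM _ ?_))
      change (C r).coeff 0 ∈ 𝔪
      rwa [coeff_C_zero]
    refine (Ideal.height_add_height_le_height_comap hIker (M.map ψ)).trans ?_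
    rw [hcomap']
    refine height_le_height_of_associatedGraded (A := reesAlgebra I)
      (j := (reesAlgebra I).val.toRingHom) (g := algebraMap R (reesAlgebra I))
      (fun y n => (mem_reesAlgebra_iff _ _).mp y.2 n) (fun r => rfl)
      (fun r hr => ⟨⟨_, reesAlgebra.monomial_one_mem hr⟩, rfl⟩) hI hπ hker M hqM
  have key := isWeaklyRegular_localization_of_height_le hψs hψker (M.map ψ) M hcomap
    (by rwa [show (xs.length : ℕ∞) = I.height by rw [hn, hxs, List.length_ofFn]]) (hG.depth_eq_dim M)
  rwa [hxs, List.map_ofFn] at key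

variable (𝒜 : ℕ → Submodule k R) [GradedAlgebra 𝒜]

/-- Injectivity is where equigeneration enters: a coefficient in `V ^ n` has degree `n * d`, whereas
`𝔪 * I ^ n` is generated in degrees at least `1 + n * d`. Surjectivity follows from `R = k + 𝔪`. -/
lemma fiberAlgebra.bijective_mk_toRees (hR : IsStandardGraded 𝒜)
    (hV : Ideal.span (V : Set R) = I) {d : ℕ} (hVd : V ≤ 𝒜 d) {F : Type*} [CommRing F]
    {π : reesAlgebra I →+* F} (hπ : Function.Surjective π)
    (hker : RingHom.ker π =
      (HomogeneousIdeal.irrelevant 𝒜).toIdeal.map (algebraMap R (reesAlgebra I))) :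
    Function.Bijective (π.comp (toRees hV)) := by
  constructor
  · rw [injective_iff_map_eq_zero]
    intro b hb
    have hb' : toRees hV b ∈ RingHom.ker π := hb
    rw [hker] at hb'
    have hIle : I ≤ idealOfDegreeGE 𝒜 d := by
      rw [← hV, Ideal.span_le]
      exact fun v hv => mem_idealOfDegreeGE 𝒜 (hVd hv)
    have hmle := hR.irrelevant_le fun v hv => mem_idealOfDegreeGE 𝒜 hv
    have hVn : ∀ n, V ^ n ≤ 𝒜 (n * d) := by
      intro n x hx
      induction hx using Submodule.pow_induction_on_left' with
      | algebraMap c =>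
        rw [zero_mul, hR.zero_eq]
        exact Submodule.mem_one.mpr ⟨c, rfl⟩
      | add x y i _ _ hx hy => exact add_mem hx hy
      | mem_mul v hv i x _ hx =>
        rw [Nat.succ_mul, add_comm]
        exact SetLike.GradedMul.mul_mem (hVd hv) hx
    refine Subtype.ext (Polynomial.ext fun n => ?_)
    refine eq_zero_of_mem_idealOfDegreeGE 𝒜 (lt_one_add (n * d)) ?_
      (hVn n (coeff_mem_pow b.2 n))
    exact ((Ideal.mul_mono hmle (pow_le_idealOfDegreeGE 𝒜 hIle n)).trans
      (idealOfDegreeGE_mul_le 𝒜 1 (n * d))) (reesAlgebra.coeff_mem_of_mem_map _ hb' n)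
  · intro y
    obtain ⟨x, rfl⟩ := hπ y
    induction x using reesAlgebra.induction_on_generators hV with
    | hC r =>
      obtain ⟨c, hc⟩ := hR.exists_sub_algebraMap_mem_irrelevant r
      refine ⟨algebraMap k _ c, ?_⟩
      have h1 := Ideal.mem_map_of_mem (algebraMap R (reesAlgebra I)) hc
      rw [← hker, RingHom.mem_ker, map_sub, map_sub, sub_eq_zero] at h1
      exact h1.symm
    | hX v hv => exact ⟨⟨monomial 1 v, Algebra.subset_adjoin ⟨v, hv, rfl⟩⟩, rfl⟩
    | hadd x y hx hy =>
      obtain ⟨b, hb⟩ := hx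
      obtain ⟨c, hc⟩ := hy
      exact ⟨b + c, by rw [map_add, hb, hc, map_add]⟩
    | hmul x y hx hy =>
      obtain ⟨b, hb⟩ := hx
      obtain ⟨c, hc⟩ := hy
      exact ⟨b * c, by rw [map_mul, hb, hc, map_mul]⟩

end FiberAlgebra

/-! ### Assembly of the theorem. -/

lemma Ideal.IsEquigenerated.exists_submodule {k R : Type*} [Field k] [CommRing R] [Algebra k R]
    [IsNoetherianRing R] {𝒜 : ℕ → Submodule k R} {d : ℕ} {I : Ideal R}
    (hI : I.IsEquigenerated 𝒜 d) :
    ∃ V : Submodule k R, V.FG ∧ V ≤ 𝒜 d ∧ Ideal.span (V : Set R) = I := by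
  have hfg : (Submodule.span R ((I : Set R) ∩ (𝒜 d : Set R))).FG := IsNoetherian.noetherian _
  obtain ⟨s, hs, hspan⟩ := (Submodule.fg_span_iff_fg_span_finset_subset _).mp hfg
  refine ⟨Submodule.span k s, ⟨s, rfl⟩, Submodule.span_le.mpr fun x hx => (hs hx).2,
    le_antisymm (Ideal.span_le.mpr ?_) ?_⟩
  · exact (Submodule.span_le (p := I.restrictScalars k)).mpr fun x hx => (hs hx).1
  · calc I = Submodule.span R s := hI.symm.trans hspan
      _ ≤ Ideal.span (Submodule.span k (s : Set R) : Set R) := Ideal.span_mono Submodule.subset_span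

/-- If `I` is equimultiple and equigenerated and `gr_I(R)` is Cohen-Macaulay, then so is the special
fiber; both are given as quotients of the Rees algebra. -/
lemma isCohenMacaulayRing_of_equimultiple {k R : Type*} [Field k] [Infinite k] [CommRing R]
    [Algebra k R] (𝒜 : ℕ → Submodule k R) [GradedAlgebra 𝒜] (hR : IsStandardGraded 𝒜)
    {d : ℕ} {I : Ideal R} (hI : I.IsEquigenerated 𝒜 d) {F G : Type*} [CommRing F] [CommRing G]
    {πF : reesAlgebra I →+* F} (hFs : Function.Surjective πF) (hFker : RingHom.ker πF =
      (HomogeneousIdeal.irrelevant 𝒜).toIdeal.map (algebraMap R (reesAlgebra I)))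
    {πG : reesAlgebra I →+* G} (hGs : Function.Surjective πG)
    (hGker : RingHom.ker πG = I.map (algebraMap R (reesAlgebra I)))
    (hmult : (I.height : WithBot ℕ∞) = ringKrullDim F) (hG : IsCohenMacaulayRing G) :
    IsCohenMacaulayRing F := by
  have := hR.nontrivial
  have := hR.isNoetherianRing
  have h𝔪 := hR.isMaximal_irrelevant
  obtain ⟨V, hfg, hVd, hV⟩ := hI.exists_submodule
  have hB := fiberAlgebra.isStandardGraded hfg
  let e : fiberAlgebra V ≃+* F :=
    RingEquiv.ofBijective _ (fiberAlgebra.bijective_mk_toRees 𝒜 hR hV hVd hFs hFker)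
  have he : ∀ b, e b = πF (fiberAlgebra.toRees hV b) := fun _ => rfl
  obtain ⟨n, a, ha, hind, hrad⟩ := hB.exists_linear_parameters
  have hn : I.height = n := by
    have h1 : (I.height : WithBot ℕ∞) = n := by
      rw [hmult, ← ringKrullDim_eq_of_ringEquiv e,
        hB.ringKrullDim_eq ha hind hrad]
    exact_mod_cast h1
  have hI𝔪 : I ≤ (HomogeneousIdeal.irrelevant 𝒜).toIdeal := by
    -- The unit ideal has height `⊤`, while `I` has the finite height `n`. This excludes a nonzero
    -- scalar generator when `d = 0`.
    have hItop : I ≠ ⊤ := by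
      rintro rfl
      rw [Ideal.height_top] at hn
      exact ENat.top_ne_natCast n hn
    have hle : (V : Set R) ⊆ (HomogeneousIdeal.irrelevant 𝒜).toIdeal := by
      intro v hv
      rcases Nat.eq_zero_or_pos d with rfl | hd
      · obtain ⟨c, rfl⟩ := Submodule.mem_one.mp (hR.zero_eq.le (hVd hv))
        have hc : c = 0 := by
          by_contra hc
          exact hItop (Ideal.eq_top_of_isUnit_mem _ (hV ▸ Ideal.subset_span hv)
            ((IsUnit.mk0 c hc).map (algebraMap k R)))
        rw [hc, map_zero]
        exact zero_mem _
      · exact HomogeneousIdeal.mem_irrelevant_of_mem _ hd (hVd hv)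
    rw [← hV]
    exact Ideal.span_le.mpr hle
  have hmap := Ideal.map_mono (f := algebraMap R (reesAlgebra I)) hI𝔪
  rw [← hGker, ← hFker] at hmap
  -- Since `I ≤ 𝔪`, the special fiber is a quotient of `G`; identifying it with the fiber algebra
  -- gives the retraction.
  let q : G →+* fiberAlgebra V :=
    (e.symm : F →+* fiberAlgebra V).comp (RingHom.liftOfSurjective πG hGs ⟨πF, hmap⟩)
  have hqπ : ∀ x, q (πG x) = e.symm (πF x) := fun x =>
    congrArg e.symm (RingHom.liftOfRightInverse_comp_apply πG _ _ ⟨πF, hmap⟩ x)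
  have hfin := fiberAlgebra.finite_flat_aeval hV hfg hI𝔪 hGs hGker hG (q := q) (fun b => by rw [hqπ, ← he, e.symm_apply_apply]) (fun x hx => by
      rw [hqπ]
      set b := e.symm (πF x) with hb
      have h1 : πF x = πF (fiberAlgebra.toRees hV b) := by rw [← he, hb, e.apply_symm_apply]
      -- `x` and `b` differ by an element of `𝔪 R[It]`, so their constant coefficients agree modulo
      -- `𝔪`; that of `b` is a scalar and therefore zero.
      have h2 : x - fiberAlgebra.toRees hV b ∈ RingHom.ker πF := by
        rw [RingHom.mem_ker, map_sub, h1, sub_self]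
      rw [hFker] at h2
      have h3 := Ideal.mul_le_left (reesAlgebra.coeff_mem_of_mem_map _ h2 0)
      rw [AddSubgroupClass.coe_sub, coeff_sub, fiberAlgebra.coe_toRees] at h3
      rw [fiberAlgebra.mem_irrelevant_iff]
      have h4 : (b : R[X]).coeff 0 ∈ (HomogeneousIdeal.irrelevant 𝒜).toIdeal := by
        simpa using Ideal.sub_mem _ hx h3
      obtain ⟨c, hc⟩ : ∃ c : k, algebraMap k R c = (b : R[X]).coeff 0 := by
        have h5 := fiberAlgebra.coeff_mem_pow b.2 0
        rw [pow_zero] at h5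
        exact Submodule.mem_one.mp h5
      rw [← hc] at h4 ⊢
      rw [hR.eq_zero_of_algebraMap_mem_irrelevant h4, map_zero]) hn ha hrad
  let _ : Algebra (MvPolynomial (Fin n) k) (F) :=
    ((e : fiberAlgebra V →+* F).comp
      (MvPolynomial.aeval (R := k) a).toRingHom).toAlgebra
  have h1 : Module.Finite (MvPolynomial (Fin n) k) (F) :=
    RingHom.Finite.comp (RingHom.Finite.of_surjective _ e.surjective) hfin.1
  have h2 : Module.Flat (MvPolynomial (Fin n) k) (F) :=
    RingHom.Flat.comp hfin.2 (RingHom.Flat.of_bijective e.bijective)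
  exact isCohenMacaulayRing_of_finite_of_flat k n _

theorem mainTheorem9 {k : Type v} {R : Type u} [Field k] [Infinite k] [CommRing R] [Algebra k R]
    (𝒜 : ℕ → Submodule k R) [GradedAlgebra 𝒜] (hR : IsStandardGraded 𝒜)
    (d : ℕ) (I : Ideal R) (hI : I.IsEquigenerated 𝒜 d) (hmult : I.IsEquimultiple 𝒜)
    (hgr : IsCohenMacaulayRing (AssociatedGradedRing I)) :
    IsCohenMacaulayRing (SpecialFiber 𝒜 I) := by
  refine isCohenMacaulayRing_of_equimultiple (F := SpecialFiber 𝒜 I)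
    (G := AssociatedGradedRing I) 𝒜 hR hI (πF := Ideal.Quotient.mk _) (πG := Ideal.Quotient.mk _)
    ?_ ?_ ?_ ?_ ?_ ?_
  · exact Ideal.Quotient.mk_surjective
  · exact Ideal.mk_ker
  · exact Ideal.Quotient.mk_surjective
  · exact Ideal.mk_ker
  · exact hmult
  · exact hgr
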